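/- **Definitions.** A $\lambda$-structure on a commutative ring $R$ is a map $\lambda_t\colon R\to 1+tR[[t]]$, $\lambda_t(r)=\sum_{n\ge 0}\lambda_n(r)t^n$, with $\lambda_t(r)=1+rt+O(t^2)$ and $\lambda_t(r+s)=\lambda_t(r)\lambda_t(s)$; its Adams operations $\psi_n$ are defined by $\sum_{n\ge1}\psi_n(r)t^n=-t\frac{d}{dt}\log\lambda_{-t}(r)$. It is special if $\lambda_t$ is a homomorphism of $\lambda$-rings to $1+tR[[t]]$, where the latter has addition given by the product of power series, unit $1+t$, multiplication $*$ given by the universal polynomials for which $\prod_i(1+x_it)*\prod_j(1+y_jt)=\prod_{i,j}(1+x_iy_jt)$, and $\lambda$-operations given by the universal polynomials for which $\lambda_k\big(\prod_i(1+x_it)\big)=\prod_{i_1<\dots<i_k}(1+x_{i_1}\cdots x_{i_k}t)$. A graded $\lambda$-ring is a graded commutative ring $R=\bigoplus_{d\ge0}R_d$ (commutative in the ordinary sense) with a $\lambda$-structure such that $\lambda_n(R_d)\subset R_{nd}$ for all $n,d$; homomorphisms of graded $\lambda$-rings are the degree-preserving ring homomorphisms that commute with all $\lambda_k$, and $\mathrm{Hom}_{\mathsf{GrLR}}$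 denotes the set of them. Let $\mathrm{PS}_{\mathbb Z}$ be the ring of formal infinite sums, with integer coefficients and bounded degree, of monomials in indeterminates $x_{ij}$ ($i,j\ge1$, $\deg x_{ij}=i$) that are invariant under all permutations of the pairs $(i,j)$ preserving the first coordinate. It is graded by degree. Let $M_d=\sum_{j\ge1}x_{dj}\in \mathrm{PS}_{\mathbb Z}$. Let $\Lambda$ be the ring of symmetric functions in indeterminates $y_1,y_2,\dots$ of degree $1$, and let $\Lambda\langle n\rangle$ be $\Lambda$ with the grading supported in the multiples of $n$ and $\Lambda\langle n\rangle_{dn}=\Lambda_d$. **Theorem.** There are $\lambda$-structures on $\Lambda$ and on $\mathrm{PS}_{\mathbb Z}$ whose Adams operations are $\psi_nf(y_*)=f(y_*^n)$ and $\psi_ng(x_{**})=g(x_{**}^n)$ for $n\ge1$, and for which the following hold. 1. Both are special, and they make each $\Lambda\langle n\rangle$ ($n\ge1$) and $\mathrm{PS}_{\mathbb Z}$ graded $\lambda$-rings. 2. The degree-preserving ring homomorphisms $\Lambda\langle n\rangle\to\mathrm{PS}_{\mathbb Z}$, $y_j\mapsto x_{nj}$, commute with the $\lambda$-operations. They exhibit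 $\mathrm{PS}_{\mathbb Z}$ as the coproduct $\bigotimes_{n\ge1}\Lambda\langle n\rangle$ of graded commutative rings, and also as the coproduct of the $\Lambda\langle n\rangle$ in the category of special graded $\lambda$-rings. 3. $\mathrm{PS}_{\mathbb Z}$ is the free special graded $\lambda$-ring with one generator in each positive degree: for every special graded $\lambda$-ring $R=\bigoplus_{d\ge0}R_d$ the map $$\mathrm{Hom}_{\mathsf{GrLR}}(\mathrm{PS}_{\mathbb Z},R)\to\prod_{d=1}^\infty R_d,\qquad \phi\mapsto(\phi(M_d))_{d\ge1}$$ is a bijection. -/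

import Mathlib

open scoped PowerSeries

universe u

/-! ### Universal polynomials -/

namespace UniversalPoly

open MvPolynomial

/-- The elementary symmetric polynomial `e_n` evaluated at the `n²` products `x_i y_j`. -/
noncomputable def esymmProducts (n : ℕ) : MvPolynomial (Fin n ⊕ Fin n) ℤ :=
  aeval (fun p : Fin n × Fin n =>
    (X (Sum.inl p.1) * X (Sum.inr p.2) : MvPolynomial (Fin n ⊕ Fin n) ℤ))
    (esymm (Fin n × Fin n) ℤ n)

/-- The elementary symmetric polynomial `e_m` evaluated at all the products
`x_{i_1} ⋯ x_{i_k}` with `i_1 < ⋯ < i_k`, in `m k` variables. -/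
noncomputable def esymmSubsets (m k : ℕ) : MvPolynomial (Fin (m * k)) ℤ :=
  aeval (fun s : {s : Finset (Fin (m * k)) // s.card = k} =>
    (∏ i ∈ s.1, X i : MvPolynomial (Fin (m * k)) ℤ))
    (esymm {s : Finset (Fin (m * k)) // s.card = k} ℤ m)

theorem map_aeval_esymm {A B : Type*} [CommRing A] [CommRing B] (f : A →+* B) (n : ℕ)
    (G : MvPolynomial (Fin n) A) :
    map f (aeval (fun i : Fin n => esymm (Fin n) A (i + 1)) G) =
      aeval (fun i : Fin n => esymm (Fin n) B (i + 1)) (map f G) := by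
  induction G using MvPolynomial.induction_on with
  | C a => simp
  | add p q hp hq => simp only [map_add, hp, hq]
  | mul_X p i hp => simp only [map_mul, hp, aeval_X, map_X, map_esymm]

theorem sumAlgEquiv_rename_left (n : ℕ) (e : Equiv.Perm (Fin n))
    (G : MvPolynomial (Fin n ⊕ Fin n) ℤ) :
    sumAlgEquiv ℤ (Fin n) (Fin n) (rename (Sum.map e id) G) =
      rename e (sumAlgEquiv ℤ (Fin n) (Fin n) G) := by
  induction G using MvPolynomial.induction_on with
  | C a => simp
  | add p q hp hq => simp only [map_add, hp, hq]
  | mul_X p i hp => cases i <;> simp [hp]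

theorem sumAlgEquiv_rename_right (n : ℕ) (e : Equiv.Perm (Fin n))
    (G : MvPolynomial (Fin n ⊕ Fin n) ℤ) :
    sumAlgEquiv ℤ (Fin n) (Fin n) (rename (Sum.map id e) G) =
      map (rename (R := ℤ) e).toRingHom (sumAlgEquiv ℤ (Fin n) (Fin n) G) := by
  induction G using MvPolynomial.induction_on with
  | C a => simp
  | add p q hp hq => simp only [map_add, hp, hq]
  | mul_X p i hp => cases i <;> simp [hp]

theorem sumAlgEquiv_rename_inl (n : ℕ) (p : MvPolynomial (Fin n) ℤ) :
    sumAlgEquiv ℤ (Fin n) (Fin n) (rename Sum.inl p) = map C p := by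
  induction p using MvPolynomial.induction_on with
  | C a => simp
  | add p q hp hq => simp only [map_add, hp, hq]
  | mul_X p i hp => simp [hp]

theorem sumAlgEquiv_rename_inr (n : ℕ) (p : MvPolynomial (Fin n) ℤ) :
    sumAlgEquiv ℤ (Fin n) (Fin n) (rename Sum.inr p) = C p := by
  induction p using MvPolynomial.induction_on with
  | C a => simp
  | add p q hp hq => simp only [map_add, hp, hq]
  | mul_X p i hp => simp [hp]

theorem sumAlgEquiv_aeval (n : ℕ) (K : MvPolynomial (Fin n ⊕ Fin n) ℤ) :
    sumAlgEquiv ℤ (Fin n) (Fin n) (aeval (Sum.elim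
        (fun i : Fin n => rename Sum.inl (esymm (Fin n) ℤ (i + 1)))
        (fun i : Fin n => rename Sum.inr (esymm (Fin n) ℤ (i + 1)))) K) =
      aeval (fun i : Fin n => esymm (Fin n) (MvPolynomial (Fin n) ℤ) (i + 1))
        (map (aeval (R := ℤ) (fun i : Fin n => esymm (Fin n) ℤ (i + 1))).toRingHom
          (sumAlgEquiv ℤ (Fin n) (Fin n) K)) := by
  induction K using MvPolynomial.induction_on with
  | C a => simp
  | add p q hp hq => simp only [map_add, hp, hq]
  | mul_X p i hp =>
    simp only [map_mul, hp]
    cases i <;>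
      simp [sumAlgEquiv_rename_inl, sumAlgEquiv_rename_inr, map_esymm]

theorem exists_of_bisymmetric (n : ℕ) (F : MvPolynomial (Fin n ⊕ Fin n) ℤ)
    (h₁ : ∀ e : Equiv.Perm (Fin n), rename (Sum.map e id) F = F)
    (h₂ : ∀ e : Equiv.Perm (Fin n), rename (Sum.map id e) F = F) :
    ∃ P : MvPolynomial (Fin n ⊕ Fin n) ℤ,
      aeval (Sum.elim
        (fun i : Fin n => rename Sum.inl (esymm (Fin n) ℤ (i + 1)))
        (fun i : Fin n => rename Sum.inr (esymm (Fin n) ℤ (i + 1)))) P = F := by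
  have hsym : (sumAlgEquiv ℤ (Fin n) (Fin n) F).IsSymmetric := fun e => by
    rw [← sumAlgEquiv_rename_left, h₁]
  obtain ⟨G, hG⟩ := (esymmAlgHom_fin_bijective (MvPolynomial (Fin n) ℤ) n).2 ⟨_, hsym⟩
  have hG' : aeval (fun i : Fin n => esymm (Fin n) (MvPolynomial (Fin n) ℤ) (i + 1)) G =
      sumAlgEquiv ℤ (Fin n) (Fin n) F := by
    rw [← esymmAlgHom_apply, hG]
  have hGe : ∀ e : Equiv.Perm (Fin n), map (rename (R := ℤ) e).toRingHom G = G := by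
    intro e
    apply (esymmAlgHom_fin_bijective (MvPolynomial (Fin n) ℤ) n).1
    apply Subtype.ext
    rw [esymmAlgHom_apply, esymmAlgHom_apply, ← map_aeval_esymm, hG',
      ← sumAlgEquiv_rename_right, h₂]
  have hmem : G ∈ Set.range (map (σ := Fin n)
      (aeval (R := ℤ) (fun i : Fin n => esymm (Fin n) ℤ (i + 1))).toRingHom) := by
    rw [mem_range_map_iff_coeffs_subset]
    intro c hc
    obtain ⟨d, -, rfl⟩ := mem_coeffs_iff.1 hc
    have hc' : (coeff d G).IsSymmetric := fun e => by
      conv_rhs => rw [← hGe e, coeff_map]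
      rfl
    obtain ⟨p, hp⟩ := (esymmAlgHom_fin_bijective ℤ n).2 ⟨_, hc'⟩
    refine ⟨p, ?_⟩
    have := congrArg Subtype.val hp
    rw [esymmAlgHom_apply] at this
    exact this
  obtain ⟨H, hH⟩ := hmem
  refine ⟨(sumAlgEquiv ℤ (Fin n) (Fin n)).symm H, ?_⟩
  apply (sumAlgEquiv ℤ (Fin n) (Fin n)).injective
  rw [sumAlgEquiv_aeval, AlgEquiv.apply_symm_apply, hH, hG']

theorem exists_mulPoly (n : ℕ) : ∃ P : MvPolynomial (Fin n ⊕ Fin n) ℤ,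
    aeval (Sum.elim
      (fun i : Fin n => rename Sum.inl (esymm (Fin n) ℤ (i + 1)))
      (fun i : Fin n => rename Sum.inr (esymm (Fin n) ℤ (i + 1)))) P = esymmProducts n := by
  apply exists_of_bisymmetric
  · intro e
    have := rename_esymm (Fin n × Fin n) ℤ n (e.prodCongr (Equiv.refl _))
    conv_rhs => rw [esymmProducts, ← this, aeval_rename]
    rw [esymmProducts, ← AlgHom.comp_apply, comp_aeval]
    congr 2
    ext1 p
    simp
  · intro e
    have := rename_esymm (Fin n × Fin n) ℤ n ((Equiv.refl _).prodCongr e)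
    conv_rhs => rw [esymmProducts, ← this, aeval_rename]
    rw [esymmProducts, ← AlgHom.comp_apply, comp_aeval]
    congr 2
    ext1 p
    simp

theorem exists_lamPoly (m k : ℕ) : ∃ P : MvPolynomial (Fin (m * k)) ℤ,
    aeval (fun i : Fin (m * k) => esymm (Fin (m * k)) ℤ (i + 1)) P = esymmSubsets m k := by
  have hsym : (esymmSubsets m k).IsSymmetric := by
    intro e
    let e' : {s : Finset (Fin (m * k)) // s.card = k} ≃
        {s : Finset (Fin (m * k)) // s.card = k} :=
      (Equiv.finsetCongr e).subtypeEquiv (fun s => by simp)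
    have := rename_esymm {s : Finset (Fin (m * k)) // s.card = k} ℤ m e'
    conv_rhs => rw [esymmSubsets, ← this, aeval_rename]
    rw [esymmSubsets, ← AlgHom.comp_apply, comp_aeval]
    congr 2
    ext1 p
    simp [e']
  obtain ⟨p, hp⟩ := (esymmAlgHom_fin_bijective ℤ (m * k)).2 ⟨_, hsym⟩
  refine ⟨p, ?_⟩
  rw [← esymmAlgHom_apply, hp]

/-- The universal polynomial `P_n(a_1, …, a_n; b_1, …, b_n)` characterised by
`P_n(e_1(x), …, e_n(x); e_1(y), …, e_n(y)) = e_n(x_i y_j : i, j)`.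
The variables `Sum.inl i`, `Sum.inr i` (`0 ≤ i < n`) are `a_{i+1}`, `b_{i+1}`. -/
noncomputable def mulPoly (n : ℕ) : MvPolynomial (Fin n ⊕ Fin n) ℤ :=
  (exists_mulPoly n).choose

/-- The universal polynomial `P_{m,k}(a_1, …, a_{mk})` characterised by
`P_{m,k}(e_1(x), …, e_{mk}(x)) = e_m(x_{i_1} ⋯ x_{i_k} : i_1 < ⋯ < i_k)`.
The variable `i` (`0 ≤ i < m k`) is `a_{i+1}`. -/
noncomputable def lamPoly (m k : ℕ) : MvPolynomial (Fin (m * k)) ℤ :=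
  (exists_lamPoly m k).choose

end UniversalPoly

/-! ### λ-structures -/

/-- A `λ`-structure on a commutative ring `R`: a map `λ_t : R → 1 + t R⟦t⟧` with
`λ_t(r) = 1 + r t + O(t²)` and `λ_t(r + s) = λ_t(r) λ_t(s)`. -/
structure LambdaStructure (R : Type*) [CommRing R] where
  series : R → R⟦X⟧
  coeff_zero : ∀ r, PowerSeries.coeff 0 (series r) = 1
  coeff_one : ∀ r, PowerSeries.coeff 1 (series r) = r
  series_add : ∀ r s, series (r + s) = series r * series s

namespace LambdaStructure

/-- Multiplication `∗` of the ring `1 + t R⟦t⟧` (whose addition is the product of power series),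
given by the universal polynomials, so that `(1 + a t) ∗ (1 + b t) = 1 + a b t`. -/
noncomputable def wittMul {R : Type*} [CommRing R] (f g : R⟦X⟧) : R⟦X⟧ :=
  PowerSeries.mk fun n =>
    MvPolynomial.aeval (Sum.elim
      (fun i : Fin n => PowerSeries.coeff (i + 1) f)
      (fun i : Fin n => PowerSeries.coeff (i + 1) g)) (UniversalPoly.mulPoly n)

/-- The `k`-th `λ`-operation of the canonical `λ`-structure on `1 + t R⟦t⟧`, given by the
universal polynomials: it sends `∏ (1 + x_i t)` to `∏_{i_1 < ⋯ < i_k} (1 + x_{i_1} ⋯ x_{i_k} t)`. -/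
noncomputable def wittLam {R : Type*} [CommRing R] (k : ℕ) (f : R⟦X⟧) : R⟦X⟧ :=
  PowerSeries.mk fun m =>
    MvPolynomial.aeval (fun i : Fin (m * k) => PowerSeries.coeff (i + 1) f)
      (UniversalPoly.lamPoly m k)

variable {R : Type*} [CommRing R] (L : LambdaStructure R)

/-- The operation `λ_n`, the coefficient of `t ^ n` in `λ_t`. -/
noncomputable def lam (n : ℕ) (r : R) : R := PowerSeries.coeff n (L.series r)

/-- The `n`-th Adams operation, defined by
`∑_{n ≥ 1} ψ_n(r) t^n = - t (d/dt) log (λ_{-t}(r))`. -/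
noncomputable def adams (n : ℕ) (r : R) : R :=
  PowerSeries.coeff n
    (-(PowerSeries.X * PowerSeries.derivative R (PowerSeries.evalNegHom (L.series r)) *
      PowerSeries.invOfUnit (PowerSeries.evalNegHom (L.series r)) 1))

/-- A `λ`-structure is special if `λ_t : R → 1 + t R⟦t⟧` is a homomorphism of `λ`-rings
(additivity is part of the definition of a `λ`-structure; the unit of `1 + t R⟦t⟧` is `1 + t`). -/
structure IsSpecial : Prop where
  series_one : L.series 1 = 1 + PowerSeries.X
  series_mul : ∀ r s, L.series (r * s) = wittMul (L.series r) (L.series s)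
  series_lam : ∀ k r, L.series (L.lam k r) = wittLam k (L.series r)

/-- `(R, λ)` is a graded `λ`-ring for the grading `R = ⨁ 𝒜 d` if `λ_n(𝒜 d) ⊆ 𝒜 (n d)`. -/
def IsGraded (𝒜 : ℕ → AddSubgroup R) : Prop :=
  ∀ n d, ∀ r ∈ 𝒜 d, L.lam n r ∈ 𝒜 (n * d)

end LambdaStructure

/-- Homomorphisms of graded `λ`-rings: ring homomorphisms that preserve degrees and commute with
all the operations `λ_k`. -/
structure GradedLambdaHom {R S : Type*} [CommRing R] [CommRing S]
    (𝒜 : ℕ → AddSubgroup R) (L : LambdaStructure R)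
    (ℬ : ℕ → AddSubgroup S) (M : LambdaStructure S) extends GradedRingHom 𝒜 ℬ where
  map_lam : ∀ k, 1 ≤ k → ∀ r, toRingHom (L.lam k r) = M.lam k (toRingHom r)

/-- The grading of `A⟨n⟩`: supported in degrees divisible by `n`, with `A⟨n⟩_{d n} = A_d`. -/
def scaledGrading {A : Type*} [CommRing A] (𝒜 : ℕ → AddSubgroup A) (n : ℕ) (d : ℕ) :
    AddSubgroup A :=
  if n ∣ d then 𝒜 (d / n) else ⊥

/-! ### Symmetric and polysymmetric functions -/

section Invariants

variable {σ : Type*} (w : σ → ℕ)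

/-- The ring of formal infinite sums of monomials in variables `x_s` of degree `w s`, with
integer coefficients and bounded degree, that are invariant under all permutations of the
variables that preserve their degrees. -/
def boundedInvariants : Subring (MvPowerSeries σ ℤ) where
  carrier := {f | (∃ N, ∀ m, MvPowerSeries.coeff m f ≠ 0 → Finsupp.weight w m ≤ N) ∧
    ∀ g : Equiv.Perm σ, (∀ s, w (g s) = w s) → MvPowerSeries.renameEquiv ℤ g f = f}
  zero_mem' := ⟨⟨0, by simp⟩, by simp⟩
  one_mem' := by
    classical
    refine ⟨⟨0, fun m hm => ?_⟩, by simp⟩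
    rw [MvPowerSeries.coeff_one] at hm
    have : m = 0 := by by_contra h; simp [h] at hm
    simp [this]
  add_mem' := by
    rintro a b ⟨⟨N, hN⟩, ha⟩ ⟨⟨M, hM⟩, hb⟩
    refine ⟨⟨max N M, fun m hm => ?_⟩, fun g hg => by rw [map_add, ha g hg, hb g hg]⟩
    by_contra! h
    have h1 : MvPowerSeries.coeff m a = 0 := by
      by_contra h'; have := hN m h'; omega
    have h2 : MvPowerSeries.coeff m b = 0 := by
      by_contra h'; have := hM m h'; omega
    simp [h1, h2] at hm
  neg_mem' := by
    rintro a ⟨⟨N, hN⟩, ha⟩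
    exact ⟨⟨N, fun m hm => hN m (by simpa using hm)⟩, fun g hg => by rw [map_neg, ha g hg]⟩
  mul_mem' := by
    classical
    rintro a b ⟨⟨N, hN⟩, ha⟩ ⟨⟨M, hM⟩, hb⟩
    refine ⟨⟨N + M, fun m hm => ?_⟩, fun g hg => by rw [map_mul, ha g hg, hb g hg]⟩
    rw [MvPowerSeries.coeff_mul] at hm
    obtain ⟨p, hp, hne⟩ := Finset.exists_ne_zero_of_sum_ne_zero hm
    rw [← Finset.HasAntidiagonal.mem_antidiagonal.1 hp, map_add]
    exact add_le_add (hN _ (left_ne_zero_of_mul hne)) (hM _ (right_ne_zero_of_mul hne))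

/-- The homogeneous elements of degree `d`: all their monomials have degree `d`. -/
def homogeneousPart (d : ℕ) : AddSubgroup (boundedInvariants w) where
  carrier := {f | ∀ m, MvPowerSeries.coeff m (f : MvPowerSeries σ ℤ) ≠ 0 → Finsupp.weight w m = d}
  zero_mem' := by simp
  add_mem' := by
    intro a b ha hb m hm
    by_contra h
    have h1 : MvPowerSeries.coeff m (a : MvPowerSeries σ ℤ) = 0 := by
      by_contra h'; exact h (ha m h')
    have h2 : MvPowerSeries.coeff m (b : MvPowerSeries σ ℤ) = 0 := by
      by_contra h'; exact h (hb m h')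
    simp [h1, h2] at hm
  neg_mem' := by
    intro a ha m hm
    exact ha m (by simpa using hm)

theorem weight_mapDomain_perm (g : Equiv.Perm σ) (hg : ∀ s, w (g s) = w s) (m : σ →₀ ℕ) :
    Finsupp.weight w (Finsupp.mapDomain g m) = Finsupp.weight w m := by
  simp [Finsupp.weight_apply, Finsupp.sum_mapDomain_index, add_mul, hg]

theorem coeff_renameEquiv_mapDomain (g : Equiv.Perm σ) (f : MvPowerSeries σ ℤ) (m : σ →₀ ℕ) :
    MvPowerSeries.coeff (Finsupp.mapDomain g m) (MvPowerSeries.renameEquiv ℤ g f) =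
      MvPowerSeries.coeff m f := by
  have := MvPowerSeries.coeff_embDomain_rename g.toEmbedding f m
  rw [Finsupp.embDomain_eq_mapDomain] at this
  exact this

theorem renameEquiv_eq_iff (g : Equiv.Perm σ) (f : MvPowerSeries σ ℤ) :
    MvPowerSeries.renameEquiv ℤ g f = f ↔
      ∀ m, MvPowerSeries.coeff (Finsupp.mapDomain g m) f = MvPowerSeries.coeff m f := by
  constructor
  · intro h m
    conv_lhs => rw [← h]
    exact coeff_renameEquiv_mapDomain g f m
  · intro h
    ext m
    obtain ⟨m', rfl⟩ : ∃ m', Finsupp.mapDomain g m' = m :=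
      ⟨Finsupp.mapDomain g.symm m, by simp [← Finsupp.mapDomain_comp]⟩
    rw [coeff_renameEquiv_mapDomain, h]

/-- The homogeneous component of degree `d`. -/
noncomputable def homogeneousComponent (d : ℕ) (f : boundedInvariants w) :
    homogeneousPart w d := by
  refine ⟨⟨MvPowerSeries.weightedHomogeneousComponent w d f.1, ⟨d, fun m hm => ?_⟩,
    fun g hg => ?_⟩, fun m hm => ?_⟩
  · rw [MvPowerSeries.coeff_weightedHomogeneousComponent] at hm
    by_contra h
    rw [if_neg (by omega)] at hm
    exact hm rfl
  · rw [renameEquiv_eq_iff]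
    intro m
    rw [MvPowerSeries.coeff_weightedHomogeneousComponent,
      MvPowerSeries.coeff_weightedHomogeneousComponent, weight_mapDomain_perm w g hg,
      (renameEquiv_eq_iff g f.1).1 (f.2.2 g hg)]
  · by_contra h
    rw [MvPowerSeries.coeff_weightedHomogeneousComponent, if_neg h] at hm
    exact hm rfl

theorem coeff_coe_sum (x : DirectSum ℕ fun d => homogeneousPart w d) (m : σ →₀ ℕ) :
    MvPowerSeries.coeff m
      (DirectSum.coeAddMonoidHom (homogeneousPart w) x : MvPowerSeries σ ℤ) =
    MvPowerSeries.coeff m (x (Finsupp.weight w m) : MvPowerSeries σ ℤ) := by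
  induction x using DirectSum.induction_on with
  | zero => simp
  | of d y =>
    rw [DirectSum.coeAddMonoidHom_of]
    by_cases h : Finsupp.weight w m = d
    · subst h; rw [DirectSum.of_eq_same]
    · rw [DirectSum.of_eq_of_ne _ _ _ h]
      simpa using not_imp_comm.1 (y.2 m) h
  | add x y hx hy => simp [hx, hy]

theorem isInternal_homogeneousPart : DirectSum.IsInternal (homogeneousPart w) := by
  constructor
  · rw [injective_iff_map_eq_zero]
    intro x hx
    refine DFinsupp.ext fun d => Subtype.ext (Subtype.ext (MvPowerSeries.ext fun m => ?_))
    by_cases h : Finsupp.weight w m = d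
    · subst h
      rw [← coeff_coe_sum, hx]
      rfl
    · by_contra h'
      exact h ((x d).2 m (by simpa using h'))
  · intro f
    obtain ⟨N, hN⟩ := f.2.1
    refine ⟨∑ d ∈ Finset.range (N + 1),
      DirectSum.of (fun d => homogeneousPart w d) d (homogeneousComponent w d f), ?_⟩
    refine Subtype.ext (MvPowerSeries.ext fun m => ?_)
    rw [coeff_coe_sum, DFinsupp.finsetSum_apply]
    by_cases hm : Finsupp.weight w m ∈ Finset.range (N + 1)
    · rw [Finset.sum_eq_single_of_mem _ hm]
      · erw [DirectSum.of_eq_same]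
        simp [homogeneousComponent, MvPowerSeries.coeff_weightedHomogeneousComponent]
      · intro d _ hd
        exact DirectSum.of_eq_of_ne _ _ _ hd.symm
    · rw [Finset.sum_eq_zero]
      · have : MvPowerSeries.coeff m f.1 = 0 := by
          by_contra h'
          have := hN m h'
          simp at hm
          omega
        rw [this]
        rfl
      · intro d hd
        exact DirectSum.of_eq_of_ne _ _ _ (by rintro rfl; exact hm hd)

noncomputable instance : GradedRing (homogeneousPart w) where
  one_mem := by
    classical
    intro m hm
    have hm' : MvPowerSeries.coeff m (1 : MvPowerSeries σ ℤ) ≠ 0 := hm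
    rw [MvPowerSeries.coeff_one] at hm'
    have : m = 0 := by by_contra h; simp [h] at hm'
    simp [this]
  mul_mem := by
    classical
    intro i j a b ha hb m hm
    have hm' : MvPowerSeries.coeff m (a.1 * b.1) ≠ 0 := hm
    rw [MvPowerSeries.coeff_mul] at hm'
    obtain ⟨p, hp, hne⟩ := Finset.exists_ne_zero_of_sum_ne_zero hm'
    rw [← Finset.HasAntidiagonal.mem_antidiagonal.1 hp, map_add, ha _ (left_ne_zero_of_mul hne),
      hb _ (right_ne_zero_of_mul hne)]
  toDecomposition := (isInternal_homogeneousPart w).chooseDecomposition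

end Invariants

/-- The ring `Λ_ℤ` of symmetric functions, in variables `y_j` (`j ≥ 1`) of degree `1`. -/
abbrev SymFun : Subring (MvPowerSeries ℕ+ ℤ) := boundedInvariants (fun _ : ℕ+ => 1)

/-- The grading of `Λ_ℤ`. -/
abbrev SymFun.grading : ℕ → AddSubgroup SymFun := homogeneousPart (fun _ : ℕ+ => 1)

/-- The ring `PS_ℤ` of polysymmetric functions, in variables `x_{ij}` (`i, j ≥ 1`) of degree `i`:
a permutation of the pairs `(i, j)` preserves degrees iff it preserves the first coordinate. -/
abbrev PolySymFun : Subring (MvPowerSeries (ℕ+ × ℕ+) ℤ) :=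
  boundedInvariants (fun p : ℕ+ × ℕ+ => (p.1 : ℕ))

/-- The grading of `PS_ℤ`. -/
abbrev PolySymFun.grading : ℕ → AddSubgroup PolySymFun :=
  homogeneousPart (fun p : ℕ+ × ℕ+ => (p.1 : ℕ))

namespace PolySymFun

open Classical in
/-- The formal sum `∑_j x_{dj}`. -/
noncomputable def sumVars (d : ℕ+) : MvPowerSeries (ℕ+ × ℕ+) ℤ :=
  fun m => if ∃ j, m = Finsupp.single (d, j) 1 then 1 else 0

open Classical in
theorem coeff_sumVars (d : ℕ+) (m : ℕ+ × ℕ+ →₀ ℕ) :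
    MvPowerSeries.coeff m (sumVars d) = if ∃ j, m = Finsupp.single (d, j) 1 then 1 else 0 := rfl

theorem weight_of_coeff_sumVars {d : ℕ+} {m : ℕ+ × ℕ+ →₀ ℕ}
    (hm : MvPowerSeries.coeff m (sumVars d) ≠ 0) :
    Finsupp.weight (fun p : ℕ+ × ℕ+ => (p.1 : ℕ)) m = d := by
  rw [coeff_sumVars] at hm
  obtain ⟨j, rfl⟩ : ∃ j, m = Finsupp.single (d, j) 1 := by
    by_contra h; rw [if_neg h] at hm; exact hm rfl
  simp [Finsupp.weight_single]

/-- The monomial polysymmetric function `M_d = ∑_j x_{dj}`, of type `(d^1)`. -/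
noncomputable def M (d : ℕ+) : PolySymFun := by
  refine ⟨sumVars d, ⟨d, fun m hm => (weight_of_coeff_sumVars hm).le⟩, fun g hg => ?_⟩
  rw [renameEquiv_eq_iff]
  intro m
  have hg1 : ∀ p, (g p).1 = p.1 := fun p => PNat.coe_injective (hg p)
  have hg2 : ∀ p, (g.symm p).1 = p.1 := fun p => by
    conv_rhs => rw [← g.apply_symm_apply p, hg1]
  have key : (∃ j, Finsupp.mapDomain g m = Finsupp.single (d, j) 1) ↔
      ∃ j, m = Finsupp.single (d, j) 1 := by
    constructor
    · rintro ⟨j, h⟩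
      refine ⟨(g.symm (d, j)).2, ?_⟩
      apply Finsupp.mapDomain_injective g.injective
      have : (d, (g.symm (d, j)).2) = g.symm (d, j) := Prod.ext (hg2 (d, j)).symm rfl
      rw [h, Finsupp.mapDomain_single, this, g.apply_symm_apply]
    · rintro ⟨j, rfl⟩
      refine ⟨(g (d, j)).2, ?_⟩
      have : (d, (g (d, j)).2) = g (d, j) := Prod.ext (hg1 (d, j)).symm rfl
      rw [Finsupp.mapDomain_single, this]
  rw [coeff_sumVars, coeff_sumVars]
  by_cases h : ∃ j, m = Finsupp.single (d, j) 1
  · rw [if_pos (key.2 h), if_pos h]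
  · rw [if_neg (fun h' => h (key.1 h')), if_neg h]

theorem M_mem (d : ℕ+) : M d ∈ grading d := fun _ hm => weight_of_coeff_sumVars hm

/-- The embedding of the variables `y_j ↦ x_{nj}`. -/
def block (n : ℕ+) : ℕ+ ↪ ℕ+ × ℕ+ := ⟨fun j => (n, j), fun _ _ h => (Prod.ext_iff.1 h).2⟩

theorem weight_block (n : ℕ+) (m : ℕ+ →₀ ℕ) :
    Finsupp.weight (fun p : ℕ+ × ℕ+ => (p.1 : ℕ)) (Finsupp.embDomain (block n) m) =
      Finsupp.weight (fun _ : ℕ+ => 1) m * n := by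
  rw [Finsupp.embDomain_eq_mapDomain, Finsupp.weight_apply, Finsupp.weight_apply,
    Finsupp.sum_mapDomain_index (by simp) (by intros; simp [add_mul]), Finsupp.sum,
    Finsupp.sum, Finset.sum_mul]
  simp only [smul_eq_mul, mul_one]
  rfl

theorem exists_of_coeff_rename_block {n : ℕ+} {f : MvPowerSeries ℕ+ ℤ} {m : ℕ+ × ℕ+ →₀ ℕ}
    (h : MvPowerSeries.coeff m (MvPowerSeries.rename (block n) f) ≠ 0) :
    ∃ k, m = Finsupp.embDomain (block n) k ∧ MvPowerSeries.coeff k f ≠ 0 := by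
  by_cases hm : m ∈ Set.range (Finsupp.mapDomain (M := ℕ) (block n))
  · obtain ⟨k, rfl⟩ := hm
    rw [← Finsupp.embDomain_eq_mapDomain] at h ⊢
    exact ⟨k, rfl, by simpa using h⟩
  · exact absurd (MvPowerSeries.coeff_rename_eq_zero _ _ hm) h

/-- The inclusion `Λ_ℤ⟨n⟩ → PS_ℤ` of graded rings induced by `y_j ↦ x_{nj}`. -/
noncomputable def incl (n : ℕ+) : GradedRingHom (scaledGrading SymFun.grading n) grading where
  toRingHom := RingHom.codRestrict
    ((MvPowerSeries.rename (R := ℤ) (block n)).toRingHom.comp SymFun.subtype) PolySymFun (by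
      rintro ⟨f, ⟨N, hN⟩, hf⟩
      refine ⟨⟨N * n, fun m hm => ?_⟩, fun g hg => ?_⟩
      · obtain ⟨k, rfl, hk⟩ := exists_of_coeff_rename_block hm
        rw [weight_block]
        exact Nat.mul_le_mul_right _ (hN k hk)
      · have hg1 : ∀ p, (g p).1 = p.1 := fun p => PNat.coe_injective (hg p)
        have hg2 : ∀ p, (g.symm p).1 = p.1 := fun p => by
          conv_rhs => rw [← g.apply_symm_apply p, hg1]
        let g' : Equiv.Perm ℕ+ :=
          { toFun := fun j => (g (n, j)).2
            invFun := fun j => (g.symm (n, j)).2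
            left_inv := fun j => by
              have : (n, (g (n, j)).2) = g (n, j) := Prod.ext (hg1 (n, j)).symm rfl
              simp only [this, g.symm_apply_apply]
            right_inv := fun j => by
              have : (n, (g.symm (n, j)).2) = g.symm (n, j) := Prod.ext (hg2 (n, j)).symm rfl
              simp only [this, g.apply_symm_apply] }
        have hgg : (g : ℕ+ × ℕ+ → ℕ+ × ℕ+) ∘ block n = block n ∘ g' := by
          funext j
          exact Prod.ext (hg1 (n, j)) rfl
        have h1 := hf g' (fun _ => rfl)
        change MvPowerSeries.rename g (MvPowerSeries.rename (block n) f) =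
          MvPowerSeries.rename (block n) f
        have h2 : MvPowerSeries.rename g' f = f := h1
        conv_rhs => rw [← h2]
        rw [MvPowerSeries.rename_rename, MvPowerSeries.rename_rename]
        simp only [hgg])
  map_mem := by
    intro d f hf m hm
    obtain ⟨k, rfl, hk⟩ := exists_of_coeff_rename_block hm
    rw [weight_block]
    unfold scaledGrading at hf
    split_ifs at hf with h
    · rw [hf k hk, Nat.div_mul_cancel h]
    · rw [AddSubgroup.mem_bot] at hf
      subst hf
      exact absurd rfl hk

end PolySymFun

/-! Everything rests on two facts: over a torsion-free ring a λ-structure is governed by its Adams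
operations, and PS is the polynomial ring over ℤ in the elementary functions `e_{ij} = λ_j(M_i)`,
the j-th elementary symmetric function of the `x_{i*}`.

The map `f ↦ -t (d/dt) log f(-t)`, called `ghost`, turns products into sums and `1 + x t` into `∑
x^n t^n`. Newton's identities invert it once division by `n` is possible, so identities between
λ-operations become identities between power sums. For specialness (`isSpecial_of_adams`), embed the
ring in an algebraically closed field, where each truncation of `λ_t(r)` splits as `∏ (1 + x_i t)`
and `ψ_n(r) = ∑ x_i^n`; the axioms then follow from multiplicativity of the `ψ_n` and `ψ_m ψ_n =
ψ_{mn}`.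

Existence is a question of integrality. On a monomial `λ_t(m) = 1 + m t` works, additivity gives
polynomials, and power series follow because a coefficient of `λ_n(f)` at `μ` depends only on the
coefficients of `f` at divisors of `μ` (`exists_isLambdaSeries`). Newton's identities and
torsion-freeness then show that invariance, bounded degree and grading are respected.

Polynomiality is a leading-term argument. Let the cost of a monomial be the sum of its second
indices. The unique cheapest monomial of `e_{ij}` is `x_{i1} ⋯ x_{ij}`; products of the `e_{ij}`
have distinct leading monomials, whence independence. A cheapest monomial of an invariant series has
exponents decreasing in `j`, so it is such a leading monomial and can be subtracted; the cost is at
most the square of the degree, so subtraction terminates.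

Ring maps out of PS are therefore free choices of images of the `e_{ij}`. For special targets, the
elements whose `λ_t` is preserved form a subring stable under all `λ_k`, so compatibility needs
checking only on the `M_d`; this yields both coproduct statements and freeness. -/

/-! ### Logarithmic derivatives of power series -/

namespace PowerSeries

section Ghost

variable {R S : Type*} [CommRing R] [CommRing S]

/-- The power series `-t (d/dt) log f(-t)`. -/
noncomputable def ghost (f : R⟦X⟧) : R⟦X⟧ :=
  -(X * derivative R (evalNegHom f) * invOfUnit (evalNegHom f) 1)

theorem coeff_evalNegHom (n : ℕ) (f : R⟦X⟧) :
    coeff n (evalNegHom f) = (-1) ^ n * coeff n f := by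
  simp [evalNegHom, coeff_rescale]

theorem evalNegHom_mul_invOfUnit {f : R⟦X⟧} (hf : coeff 0 f = 1) :
    evalNegHom f * invOfUnit (evalNegHom f) 1 = 1 := by
  apply mul_invOfUnit
  rw [← coeff_zero_eq_constantCoeff_apply, coeff_evalNegHom, hf]
  simp

theorem ghost_mul_evalNegHom {f : R⟦X⟧} (hf : coeff 0 f = 1) :
    ghost f * evalNegHom f = -(X * derivative R (evalNegHom f)) := by
  have h := evalNegHom_mul_invOfUnit hf
  rw [ghost]
  linear_combination (-(X * derivative R (evalNegHom f))) * h

/-- Since `f(-t)` is a unit, its logarithmic derivative is the only solution of this linear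
equation. Ghosts are computed below by verifying it, without handling the inverse series. -/
theorem eq_ghost_of_mul {f G : R⟦X⟧} (hf : coeff 0 f = 1)
    (h : G * evalNegHom f = -(X * derivative R (evalNegHom f))) : G = ghost f := by
  have h' := evalNegHom_mul_invOfUnit hf
  rw [ghost]
  linear_combination (invOfUnit (evalNegHom f) 1) * h - G * h'

theorem coeff_zero_mul_eq_one {f g : R⟦X⟧} (hf : coeff 0 f = 1) (hg : coeff 0 g = 1) :
    coeff 0 (f * g) = 1 := by
  rw [coeff_zero_eq_constantCoeff_apply] at *
  rw [map_mul, hf, hg, one_mul]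

theorem ghost_mul {f g : R⟦X⟧} (hf : coeff 0 f = 1) (hg : coeff 0 g = 1) :
    ghost (f * g) = ghost f + ghost g := by
  symm
  apply eq_ghost_of_mul (coeff_zero_mul_eq_one hf hg)
  have h1 := ghost_mul_evalNegHom hf
  have h2 := ghost_mul_evalNegHom hg
  rw [map_mul, Derivation.leibniz, smul_eq_mul, smul_eq_mul]
  linear_combination evalNegHom g * h1 + evalNegHom f * h2

theorem ghost_one : ghost (1 : R⟦X⟧) = 0 := by
  symm
  apply eq_ghost_of_mul (by simp)
  simp

theorem ghost_prod {ι : Type*} (s : Finset ι) (f : ι → R⟦X⟧) (hf : ∀ i, coeff 0 (f i) = 1) :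
    coeff 0 (∏ i ∈ s, f i) = 1 ∧ ghost (∏ i ∈ s, f i) = ∑ i ∈ s, ghost (f i) := by
  classical
  induction s using Finset.induction_on with
  | empty => simp [ghost_one]
  | insert a s ha ih =>
    rw [Finset.prod_insert ha, Finset.sum_insert ha, ghost_mul (hf a) ih.1, ih.2]
    exact ⟨coeff_zero_mul_eq_one (hf a) ih.1, rfl⟩

theorem coeff_zero_ghost (f : R⟦X⟧) : coeff 0 (ghost f) = 0 := by
  simp [ghost, mul_assoc]

theorem coeff_X_mul_derivative (n : ℕ) (f : R⟦X⟧) :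
    coeff n (X * derivative R f) = n * coeff n f := by
  cases n with
  | zero => simp
  | succ n =>
    rw [coeff_succ_X_mul, coeff_derivative, mul_comm]
    push_cast
    rfl

theorem coeff_ghost_one_add_C_mul_X (x : R) {n : ℕ} (hn : n ≠ 0) :
    coeff n (ghost (1 + C x * X)) = x ^ n := by
  have : ghost (1 + C x * X) = mk fun n => if n = 0 then 0 else x ^ n := by
    symm
    apply eq_ghost_of_mul (by simp)
    have h1 : evalNegHom (1 + C x * X) = 1 - X * C x := by
      ext n
      rw [coeff_evalNegHom]
      rcases n with _ | _ | n <;> simp [coeff_one, mul_comm X]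
    rw [h1]
    ext n
    rw [map_neg, coeff_X_mul_derivative, mul_sub, mul_one, ← mul_assoc, map_sub, coeff_mul_C,
      coeff_mk]
    rcases n with _ | _ | n <;> simp [coeff_one, coeff_X, coeff_succ_mul_X, coeff_mul_C, pow_succ]
  rw [this, coeff_mk, if_neg hn]

/-- Newton's identities. -/
theorem newton {f : R⟦X⟧} (hf : coeff 0 f = 1) (n : ℕ) :
    n * coeff n f = ∑ p ∈ Finset.HasAntidiagonal.antidiagonal n,
      (-1) ^ (p.1 + 1) * (coeff p.1 (ghost f) * coeff p.2 f) := by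
  have h := congrArg (coeff n) (ghost_mul_evalNegHom hf)
  rw [map_neg, coeff_X_mul_derivative, coeff_mul, coeff_evalNegHom] at h
  have h2 : (n : R) * coeff n f = (-1) ^ (n + 1) * -(n * ((-1) ^ n * coeff n f)) := by
    have : ((-1 : R) ^ n) * (-1) ^ n = 1 := by rw [← mul_pow]; simp
    linear_combination (-(n : R) * coeff n f) * this
  rw [h2, ← h, Finset.mul_sum]
  refine Finset.sum_congr rfl fun p hp => ?_
  rw [coeff_evalNegHom, ← Finset.HasAntidiagonal.mem_antidiagonal.1 hp]
  have : ((-1 : R) ^ p.2) * (-1) ^ p.2 = 1 := by rw [← mul_pow]; simp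
  linear_combination ((-1) ^ (p.1 + 1) * (coeff p.1 (ghost f) * coeff p.2 f)) * this

/-- Up to signs these identities are the coefficients of the equation in `eq_ghost_of_mul`, so no
division by `n` is involved. This recognises the ghost of a series built coefficient by coefficient.
-/
theorem eq_ghost_of_newton {f G : R⟦X⟧} (hf : coeff 0 f = 1)
    (h : ∀ n : ℕ, n * coeff n f = ∑ p ∈ Finset.HasAntidiagonal.antidiagonal n,
      (-1) ^ (p.1 + 1) * (coeff p.1 G * coeff p.2 f)) : G = ghost f := by
  apply eq_ghost_of_mul hf
  ext n
  rw [map_neg, coeff_X_mul_derivative, coeff_mul, coeff_evalNegHom]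
  have h2 : -((n : R) * ((-1) ^ n * coeff n f)) = (-1) ^ (n + 1) * (n * coeff n f) := by ring
  rw [h2, h, Finset.mul_sum]
  refine Finset.sum_congr rfl fun p hp => ?_
  rw [coeff_evalNegHom, ← Finset.HasAntidiagonal.mem_antidiagonal.1 hp]
  have : ((-1 : R) ^ p.1) * (-1) ^ p.1 = 1 := by rw [← mul_pow]; simp
  linear_combination (-(-1) ^ p.2 * (coeff p.1 G * coeff p.2 f)) * this

/-- In characteristic zero a power series with constant coefficient one is determined by its
logarithmic derivative, degree by degree. -/
theorem coeff_eq_of_ghost_eq [IsDomain R] [CharZero R] {f g : R⟦X⟧} (hf : coeff 0 f = 1)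
    (hg : coeff 0 g = 1) {N : ℕ}
    (h : ∀ n, n ≠ 0 → n ≤ N → coeff n (ghost f) = coeff n (ghost g)) :
    ∀ n ≤ N, coeff n f = coeff n g := by
  intro n
  induction n using Nat.strong_induction_on with
  | _ n ih =>
    intro hn
    rcases eq_or_ne n 0 with rfl | h0
    · rw [hf, hg]
    apply mul_left_cancel₀ (Nat.cast_ne_zero.2 h0 : (n : R) ≠ 0)
    rw [newton hf, newton hg]
    refine Finset.sum_congr rfl fun p hp => ?_
    have hp' := Finset.HasAntidiagonal.mem_antidiagonal.1 hp
    rcases eq_or_ne p.1 0 with h1 | h1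
    · rw [h1, coeff_zero_ghost, coeff_zero_ghost, zero_mul, zero_mul]
    · rw [h _ h1 (by omega), ih _ (by omega) (by omega)]

theorem eq_of_ghost_eq [IsDomain R] [CharZero R] {f g : R⟦X⟧} (hf : coeff 0 f = 1)
    (hg : coeff 0 g = 1) (h : ∀ n, n ≠ 0 → coeff n (ghost f) = coeff n (ghost g)) : f = g := by
  ext n
  exact coeff_eq_of_ghost_eq hf hg (fun n h0 _ => h n h0) n le_rfl

/-- In Newton's identity the top ghost coefficient is multiplied by `± f_0 = ± 1`, so it can be
solved for over any commutative ring. -/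
theorem coeff_ghost_eq_of_coeff_eq {f g : R⟦X⟧} (hf : coeff 0 f = 1) (hg : coeff 0 g = 1) {N : ℕ}
    (h : ∀ n ≤ N, coeff n f = coeff n g) :
    ∀ n ≤ N, coeff n (ghost f) = coeff n (ghost g) := by
  intro n
  induction n using Nat.strong_induction_on with
  | _ n ih =>
    intro hn
    have h1 := newton hf n
    have h2 := newton hg n
    rw [h n hn, h2, Finset.Nat.sum_antidiagonal_eq_sum_range_succ_mk,
      Finset.Nat.sum_antidiagonal_eq_sum_range_succ_mk,
      Finset.sum_range_succ, Finset.sum_range_succ] at h1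
    have h3 : ∀ i ∈ Finset.range n, coeff i (ghost g) * coeff (n - i) g =
        coeff i (ghost f) * coeff (n - i) f := fun i hi => by
      rw [Finset.mem_range] at hi
      rw [ih i hi (by omega), h _ (by omega)]
    have h4 : ∑ i ∈ Finset.range n, (-1) ^ (i + 1) * (coeff i (ghost g) * coeff (n - i) g) =
        ∑ i ∈ Finset.range n, (-1) ^ (i + 1) * (coeff i (ghost f) * coeff (n - i) f) :=
      Finset.sum_congr rfl fun i hi => by rw [h3 i hi]
    rw [h4, Nat.sub_self, hf, hg, mul_one, mul_one] at h1
    have h5 := add_left_cancel h1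
    have : ((-1 : R) ^ (n + 1)) * (-1) ^ (n + 1) = 1 := by rw [← mul_pow]; simp
    linear_combination (coeff n (ghost g) - coeff n (ghost f)) * this - (-1) ^ (n + 1) * h5

theorem map_evalNegHom (φ : R →+* S) (f : R⟦X⟧) :
    map φ (evalNegHom f) = evalNegHom (map φ f) := by
  ext n
  simp [coeff_evalNegHom]

theorem map_ghost (φ : R →+* S) {f : R⟦X⟧} (hf : coeff 0 f = 1) :
    map φ (ghost f) = ghost (map φ f) := by
  apply eq_ghost_of_mul (by rw [coeff_map, hf, map_one])
  rw [← map_evalNegHom, ← map_mul, ghost_mul_evalNegHom hf]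
  ext n
  rw [coeff_map, map_neg, map_neg, map_neg, coeff_X_mul_derivative, coeff_X_mul_derivative]
  simp

/-- The series `∏ (1 + x_i t)`. -/
noncomputable def linearProd {ι : Type*} [Fintype ι] (x : ι → R) : R⟦X⟧ :=
  ∏ i, (1 + C (x i) * X)

theorem coeff_zero_linearProd {ι : Type*} [Fintype ι] (x : ι → R) :
    coeff 0 (linearProd x) = 1 :=
  (ghost_prod _ _ fun i => by simp).1

theorem coeff_ghost_linearProd {ι : Type*} [Fintype ι] (x : ι → R) {n : ℕ} (hn : n ≠ 0) :
    coeff n (ghost (linearProd x)) = ∑ i, x i ^ n := by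
  rw [linearProd, (ghost_prod _ _ fun i => by simp).2, map_sum]
  exact Finset.sum_congr rfl fun i _ => coeff_ghost_one_add_C_mul_X _ hn

theorem coeff_prod_one_add_C_mul_X {ι : Type*} (t : Finset ι) (x : ι → R) (n : ℕ) :
    coeff n (∏ i ∈ t, (1 + C (x i) * X)) = ∑ s ∈ Finset.powersetCard n t, ∏ i ∈ s, x i := by
  classical
  rw [Finset.prod_one_add, map_sum, ← Finset.sum_filter_add_sum_filter_not
    t.powerset (fun s : Finset ι => s.card = n), Finset.powersetCard_eq_filter]
  have h : ∀ s : Finset ι, coeff n (∏ i ∈ s, (C (x i) * X : R⟦X⟧)) =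
      if s.card = n then ∏ i ∈ s, x i else 0 := fun s => by
    rw [Finset.prod_mul_distrib, Finset.prod_const, ← map_prod, coeff_C_mul, coeff_X_pow]
    simp [eq_comm]
  simp only [h]
  rw [Finset.sum_congr rfl fun s hs => if_pos (Finset.mem_filter.1 hs).2,
    Finset.sum_eq_zero fun s hs => if_neg (Finset.mem_filter.1 hs).2, add_zero]

theorem coeff_linearProd {ι : Type*} [Fintype ι] (x : ι → R) (n : ℕ) :
    coeff n (linearProd x) = ∑ s ∈ Finset.powersetCard n Finset.univ, ∏ i ∈ s, x i :=
  coeff_prod_one_add_C_mul_X _ _ _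

theorem coeff_linearProd_eq_aeval_esymm {ι : Type*} [Fintype ι] (x : ι → R) (n : ℕ) :
    coeff n (linearProd x) = MvPolynomial.aeval x (MvPolynomial.esymm ι ℤ n) := by
  rw [coeff_linearProd, MvPolynomial.esymm, map_sum]
  simp

/-- Reversing the truncation of `f` at degree `N` makes `f_0 = 1` the leading coefficient, so the
resulting polynomial is monic with exactly `N` roots. The `x_i` are their negatives; zero roots give
trivial factors. -/
theorem exists_linearProd {K : Type*} [Field K] [IsAlgClosed K] {f : K⟦X⟧} (hf : coeff 0 f = 1)
    (N : ℕ) : ∃ x : Fin N → K, ∀ n ≤ N, coeff n f = coeff n (linearProd x) := by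
  let q : Polynomial K := ∑ n ∈ Finset.range (N + 1), Polynomial.monomial (N - n) (coeff n f)
  have hc : ∀ n ≤ N, q.coeff (N - n) = coeff n f := fun n hn => by
    simp only [q, Polynomial.finsetSum_coeff, Polynomial.coeff_monomial]
    rw [Finset.sum_eq_single_of_mem n (by simp; omega), if_pos rfl]
    intro b hb hbn
    rw [Finset.mem_range] at hb
    rw [if_neg (by omega)]
  have hd : q.natDegree ≤ N := by
    refine Polynomial.natDegree_sum_le_of_forall_le _ _ fun n _ => ?_
    exact (Polynomial.natDegree_monomial_le _).trans (Nat.sub_le _ _)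
  have hN : q.coeff N = 1 := by rw [← hf, ← hc 0 (Nat.zero_le _), Nat.sub_zero]
  have hd' : q.natDegree = N :=
    le_antisymm hd (Polynomial.le_natDegree_of_ne_zero (by rw [hN]; exact one_ne_zero))
  have hm : q.Monic := by rw [Polynomial.Monic, Polynomial.leadingCoeff, hd', hN]
  have hs := IsAlgClosed.splits q
  have hcard : Multiset.card q.roots = N := by rw [← hs.natDegree_eq_card_roots, hd']
  obtain ⟨l, hl⟩ := Quot.exists_rep q.roots
  have hll : l.length = N := by rw [← hcard, ← hl]; rfl
  subst hll
  refine ⟨fun i => -l.get i, fun n hn => ?_⟩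
  have hroots : q.roots = (Finset.univ : Finset (Fin l.length)).val.map l.get := by
    rw [← hl]
    simp
  rw [← hc n hn, coeff_linearProd_eq_aeval_esymm, MvPolynomial.aeval_esymm_eq_multiset_esymm]
  conv_lhs => rw [hs.eq_prod_roots_of_monic hm, hroots]
  rw [Multiset.map_map]
  have := Multiset.prod_X_add_C_coeff
    ((Finset.univ : Finset (Fin l.length)).val.map fun i => -l.get i) (k := l.length - n) (by simp)
  rw [Multiset.map_map] at this
  simp only [Function.comp_def, map_neg, ← sub_eq_add_neg, Multiset.card_map, Finset.card_val,
    Finset.card_univ, Fintype.card_fin, Nat.sub_sub_self hn] at this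
  simpa [Function.comp_def] using this

end Ghost

end PowerSeries

/-! ### Special `λ`-structures from Adams operations -/

namespace UniversalPoly

open MvPolynomial

theorem aeval_mulPoly (n : ℕ) :
    aeval (Sum.elim
      (fun i : Fin n => rename Sum.inl (esymm (Fin n) ℤ (i + 1)))
      (fun i : Fin n => rename Sum.inr (esymm (Fin n) ℤ (i + 1)))) (mulPoly n) =
      esymmProducts n :=
  (exists_mulPoly n).choose_spec

theorem aeval_lamPoly (m k : ℕ) :
    aeval (fun i : Fin (m * k) => esymm (Fin (m * k)) ℤ (i + 1)) (lamPoly m k) =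
      esymmSubsets m k :=
  (exists_lamPoly m k).choose_spec

end UniversalPoly

namespace LambdaStructure

open PowerSeries

/-! ### Naturality of the universal operations and their values on split series -/

section WittNaturality

variable {R S : Type*} [CommRing R] [CommRing S]

theorem map_wittMul (φ : R →+* S) (f g : R⟦X⟧) :
    PowerSeries.map φ (wittMul f g) = wittMul (PowerSeries.map φ f) (PowerSeries.map φ g) := by
  have h : ∀ a, φ a = φ.toIntAlgHom a := fun _ => rfl
  ext n
  rw [coeff_map, wittMul, wittMul, coeff_mk, coeff_mk, h,
    ← AlgHom.comp_apply, MvPolynomial.comp_aeval]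
  congr 2
  ext1 i
  cases i <;> simp

theorem map_wittLam (φ : R →+* S) (k : ℕ) (f : R⟦X⟧) :
    PowerSeries.map φ (wittLam k f) = wittLam k (PowerSeries.map φ f) := by
  have h : ∀ a, φ a = φ.toIntAlgHom a := fun _ => rfl
  ext n
  rw [coeff_map, wittLam, wittLam, coeff_mk, coeff_mk, h,
    ← AlgHom.comp_apply, MvPolynomial.comp_aeval]
  congr 2

/-- The universal polynomial for the n-th coefficient involves only coefficients of index 1 to `n`,
so agreement with `n` linear factors through degree `n` suffices; its defining identity is then
specialised at the roots. -/
theorem coeff_wittMul_of_linearProd {n : ℕ} {f g : R⟦X⟧} {x y : Fin n → R}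
    (hf : ∀ i ≤ n, coeff i f = coeff i (linearProd x))
    (hg : ∀ i ≤ n, coeff i g = coeff i (linearProd y)) :
    coeff n (wittMul f g) = coeff n (linearProd fun p : Fin n × Fin n => x p.1 * y p.2) := by
  have h := congrArg (MvPolynomial.aeval (Sum.elim x y)) (UniversalPoly.aeval_mulPoly n)
  rw [UniversalPoly.esymmProducts, ← AlgHom.comp_apply, ← AlgHom.comp_apply,
    MvPolynomial.comp_aeval, MvPolynomial.comp_aeval] at h
  rw [wittMul, coeff_mk, coeff_linearProd_eq_aeval_esymm]
  convert! h using 2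
  · congr 1
    ext1 i
    rcases i with i | i
    · simp [hf (i + 1) (by omega), coeff_linearProd_eq_aeval_esymm, MvPolynomial.aeval_rename]
    · simp [hg (i + 1) (by omega), coeff_linearProd_eq_aeval_esymm, MvPolynomial.aeval_rename]
  · congr 1
    ext1 p
    simp

theorem coeff_wittLam_of_linearProd {m k : ℕ} {f : R⟦X⟧} {x : Fin (m * k) → R}
    (hf : ∀ i ≤ m * k, coeff i f = coeff i (linearProd x)) :
    coeff m (wittLam k f) = coeff m (linearProd fun s : {s : Finset (Fin (m * k)) // s.card = k} =>
      ∏ i ∈ s.1, x i) := by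
  have h := congrArg (MvPolynomial.aeval x) (UniversalPoly.aeval_lamPoly m k)
  rw [UniversalPoly.esymmSubsets, ← AlgHom.comp_apply, ← AlgHom.comp_apply,
    MvPolynomial.comp_aeval, MvPolynomial.comp_aeval] at h
  rw [wittLam, coeff_mk, coeff_linearProd_eq_aeval_esymm]
  convert! h using 2
  · congr 1
    ext1 i
    simp [hf (i + 1) (by omega), coeff_linearProd_eq_aeval_esymm]
  · congr 1
    ext1 p
    simp

end WittNaturality

variable {R S : Type*} [CommRing R] [CommRing S] (L : LambdaStructure R) (M : LambdaStructure S)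

theorem adams_eq (n : ℕ) (r : R) : L.adams n r = coeff n (ghost (L.series r)) := rfl

theorem lam_zero (r : R) : L.lam 0 r = 1 := L.coeff_zero r

theorem lam_one (r : R) : L.lam 1 r = r := L.coeff_one r

theorem series_zero : L.series 0 = 1 := by
  have h := L.series_add 0 0
  rw [add_zero] at h
  have h1 : L.series 0 * invOfUnit (L.series 0) 1 = 1 := by
    apply mul_invOfUnit
    rw [← coeff_zero_eq_constantCoeff_apply, L.coeff_zero, Units.val_one]
  linear_combination (1 - L.series 0) * h1 - invOfUnit (L.series 0) 1 * h

theorem lam_of_zero {n : ℕ} (hn : n ≠ 0) : L.lam n 0 = 0 := by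
  rw [lam, series_zero, PowerSeries.coeff_one, if_neg hn]

theorem newton (n : ℕ) (r : R) :
    n * L.lam n r = ∑ p ∈ Finset.HasAntidiagonal.antidiagonal n,
      (-1) ^ (p.1 + 1) * (L.adams p.1 r * L.lam p.2 r) :=
  PowerSeries.newton (L.coeff_zero r) n

theorem adams_zero (r : R) : L.adams 0 r = 0 := coeff_zero_ghost _

variable {L M}

/-- In characteristic zero, a ring homomorphism that commutes with the Adams operations commutes
with `λ_t`. -/
theorem map_series_of_adams [IsDomain S] [CharZero S] (φ : R →+* S) (r : R)
    (h : ∀ n, n ≠ 0 → φ (L.adams n r) = M.adams n (φ r)) :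
    PowerSeries.map φ (L.series r) = M.series (φ r) := by
  apply eq_of_ghost_eq (by rw [coeff_map, L.coeff_zero, map_one]) (M.coeff_zero _)
  intro n hn
  rw [← map_ghost _ (L.coeff_zero r), coeff_map]
  exact h n hn

theorem map_lam_of_adams [IsDomain S] [CharZero S] (φ : R →+* S) (r : R)
    (h : ∀ n, n ≠ 0 → φ (L.adams n r) = M.adams n (φ r)) (k : ℕ) :
    φ (L.lam k r) = M.lam k (φ r) := by
  rw [lam, lam, ← map_series_of_adams φ r h, coeff_map]

/-- A `λ`-structure on a domain of characteristic zero is special if its Adams operations are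
commuting ring homomorphisms `ψ n` with `ψ m ∘ ψ n = ψ (m n)`. -/
theorem isSpecial_of_adams [IsDomain R] [CharZero R] (ψ : ℕ → R →+* R)
    (hL : ∀ n, n ≠ 0 → ∀ r, L.adams n r = ψ n r)
    (hψ : ∀ m n, m ≠ 0 → n ≠ 0 → ∀ r, ψ m (ψ n r) = ψ (m * n) r) : L.IsSpecial := by
  -- All identities are checked after the injection `φ` into an algebraically closed field, where
  -- truncations of `λ_t` split.
  let K := AlgebraicClosure (FractionRing R)
  let φ : R →+* K := (algebraMap (FractionRing R) K).comp (algebraMap R (FractionRing R))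
  have hφ : Function.Injective φ :=
    (algebraMap (FractionRing R) K).injective.comp (IsFractionRing.injective R (FractionRing R))
  have : CharZero K := ⟨fun a b h => Nat.cast_injective (R := R) (hφ (by simpa using h))⟩
  have h0 : ∀ r, coeff 0 (PowerSeries.map φ (L.series r)) = 1 := fun r => by
    rw [coeff_map, L.coeff_zero, map_one]
  have hg : ∀ n, n ≠ 0 → ∀ r, coeff n (ghost (PowerSeries.map φ (L.series r))) = φ (ψ n r) := by
    intro n hn r
    rw [← map_ghost _ (L.coeff_zero r), coeff_map, ← hL n hn, adams_eq]
  -- The power sums of the formal roots of `λ_t(r)` are the Adams operations of `r`, as far as the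
  -- truncation reaches.
  have hlin : ∀ (N : ℕ) (r : R) (x : Fin N → K),
      (∀ n ≤ N, coeff n (PowerSeries.map φ (L.series r)) = coeff n (linearProd x)) →
      ∀ n ≤ N, n ≠ 0 → φ (ψ n r) = ∑ i, x i ^ n := by
    intro N r x hx n hn hn0
    rw [← hg n hn0, coeff_ghost_eq_of_coeff_eq (h0 r) (coeff_zero_linearProd x) hx n hn,
      coeff_ghost_linearProd x hn0]
  refine ⟨?_, fun r s => ?_, fun k r => ?_⟩
  · have h1 : (1 + X : R⟦X⟧) = 1 + C 1 * X := by rw [map_one, one_mul]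
    rw [h1]
    apply eq_of_ghost_eq (L.coeff_zero _) (by simp)
    intro n hn
    rw [coeff_ghost_one_add_C_mul_X _ hn, ← adams_eq, hL n hn, map_one, one_pow]
  · ext n
    apply hφ
    rw [← coeff_map, ← coeff_map, map_wittMul]
    obtain ⟨x, hx⟩ := exists_linearProd (h0 r) n
    obtain ⟨y, hy⟩ := exists_linearProd (h0 s) n
    rw [coeff_wittMul_of_linearProd hx hy]
    refine coeff_eq_of_ghost_eq (h0 _) (coeff_zero_linearProd _) (fun m hm0 hm => ?_) n le_rfl
    rw [hg m hm0, coeff_ghost_linearProd _ hm0, map_mul, map_mul, hlin n r x hx m hm hm0,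
      hlin n s y hy m hm hm0, Finset.sum_mul_sum, Fintype.sum_prod_type]
    simp only [mul_pow]
  · ext m
    apply hφ
    rw [← coeff_map, ← coeff_map, map_wittLam]
    obtain ⟨x, hx⟩ := exists_linearProd (h0 r) (m * k)
    rw [coeff_wittLam_of_linearProd hx]
    refine coeff_eq_of_ghost_eq (h0 _) (coeff_zero_linearProd _) (fun n hn0 hn => ?_) m le_rfl
    -- `ψ_n` commutes with every `ψ_i`, hence with every `λ_k`.
    have h1 : ψ n (L.lam k r) = L.lam k (ψ n r) := by
      refine map_lam_of_adams (ψ n) r (fun i hi => ?_) k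
      rw [hL i hi, hL i hi, hψ n i hn0 hi, hψ i n hi hn0, mul_comm]
    rw [hg n hn0, coeff_ghost_linearProd _ hn0, h1, lam, ← coeff_map]
    -- The formal roots of `ψ_n(r)` are the `x_i^n`: the i-th power sum of these is `ψ_{in}(r)`, and
    -- `i n ≤ m k` stays in the range of the truncation. So `λ_k(ψ_n r)` is `e_k` of the `x_i^n`,
    -- which is the n-th power sum of the k-fold products of the `x_i`.
    have h2 : coeff k (PowerSeries.map φ (L.series (ψ n r))) =
        coeff k (linearProd fun i => x i ^ n) := by
      refine coeff_eq_of_ghost_eq (h0 _) (coeff_zero_linearProd _) (fun i hi0 hi => ?_) k le_rfl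
      rw [hg i hi0, hψ i n hi0 hn0, coeff_ghost_linearProd _ hi0,
        hlin (m * k) r x hx (i * n) (by rw [mul_comm]; exact Nat.mul_le_mul hn hi)
          (Nat.mul_ne_zero hi0 hn0)]
      simp only [← pow_mul, mul_comm]
    rw [h2, coeff_linearProd, Finset.sum_subtype (p := fun s => s.card = k) (F := inferInstance) _ (by simp)]
    simp only [Finset.prod_pow]

end LambdaStructure

/-! ### The `λ`-structure on power series whose Adams operations raise the variables to powers -/

namespace MvPowerSeries

section Expand

variable {σ τ : Type*}

/-- The alternative depends on `m` alone, not on `f`, so it can be used to compare two series. -/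
theorem coeff_expand_cases (n : ℕ) (hn : n ≠ 0) (m : σ →₀ ℕ) :
    (∃ k, m = n • k ∧ ∀ f : MvPowerSeries σ ℤ, coeff m (expand n hn f) = coeff k f) ∨
      ∀ f : MvPowerSeries σ ℤ, coeff m (expand n hn f) = 0 := by
  by_cases h : ∀ i, n ∣ m i
  · have hm : m = n • m.mapRange (fun a => a / n) (by simp) := by
      ext i
      simp [Nat.mul_div_cancel' (h i)]
    refine Or.inl ⟨_, hm, fun f => ?_⟩
    conv_lhs => rw [hm]
    rw [coeff_expand_smul]
  · push Not at h
    obtain ⟨i, hi⟩ := h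
    exact Or.inr fun f => coeff_expand_of_not_dvd n hn f hi

theorem expand_rename (n : ℕ) (hn : n ≠ 0) (e : σ → τ) [Filter.TendstoCofinite e]
    (f : MvPowerSeries σ ℤ) : expand n hn (rename e f) = rename e (expand n hn f) := by
  rw [rename_eq_subst, rename_eq_subst, expand_subst n hn (HasSubst.X_comp e), expand, expand,
    substAlgHom_apply, subst_comp_subst_apply (HasSubst.X_pow hn) (HasSubst.X_comp e)]
  congr 1
  ext1 i
  rw [subst_pow (HasSubst.X_comp e), subst_X (HasSubst.X_comp e), substAlgHom_apply]
  simp [subst_X (HasSubst.X_pow hn)]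

end Expand

/-! ### Congruence of power series up to a given monomial -/

section AgreeBelow

variable {σ : Type*}

/-- The coefficients of `f` and `g` at all divisors of the monomial `μ` agree. -/
def AgreeBelow (μ : σ →₀ ℕ) (f g : MvPowerSeries σ ℤ) : Prop :=
  ∀ κ ≤ μ, coeff κ f = coeff κ g

namespace AgreeBelow

variable {μ : σ →₀ ℕ} {f g f' g' : MvPowerSeries σ ℤ}

theorem refl (f : MvPowerSeries σ ℤ) : AgreeBelow μ f f := fun _ _ => rfl

theorem mul (h : AgreeBelow μ f g) (h' : AgreeBelow μ f' g') : AgreeBelow μ (f * f') (g * g') := by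
  classical
  intro κ hκ
  rw [coeff_mul, coeff_mul]
  refine Finset.sum_congr rfl fun p hp => ?_
  have hp' := Finset.HasAntidiagonal.mem_antidiagonal.1 hp
  rw [h _ (le_trans (hp' ▸ le_self_add) hκ), h' _ (le_trans (hp' ▸ le_add_self) hκ)]

theorem sum {ι : Type*} {s : Finset ι} {f g : ι → MvPowerSeries σ ℤ}
    (h : ∀ i ∈ s, AgreeBelow μ (f i) (g i)) : AgreeBelow μ (∑ i ∈ s, f i) (∑ i ∈ s, g i) := by
  intro κ hκ
  rw [map_sum, map_sum]
  exact Finset.sum_congr rfl fun i hi => h i hi κ hκ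

theorem of_natCast_mul {n : ℕ} (hn : n ≠ 0) (h : AgreeBelow μ (n * f) (n * g)) :
    AgreeBelow μ f g := by
  intro κ hκ
  have := h κ hκ
  rw [← nsmul_eq_mul, ← nsmul_eq_mul, map_nsmul, map_nsmul] at this
  exact nsmul_right_injective hn this

theorem expand (h : AgreeBelow μ f g) (n : ℕ) (hn : n ≠ 0) :
    AgreeBelow μ (f.expand n hn) (g.expand n hn) := by
  intro κ hκ
  rcases coeff_expand_cases n hn κ with ⟨k, rfl, hk⟩ | h0
  · rw [hk, hk]
    exact h k (le_trans (le_self_nsmul zero_le hn) hκ)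
  · rw [h0, h0]

end AgreeBelow

end AgreeBelow

/-! ### Existence and uniqueness of λ_t with prescribed Adams operations -/

section AdamsSeries

variable {σ : Type*}

/-- The series `∑_{n ≥ 1} f(x^n) t^n`. -/
noncomputable def adamsSeries : MvPowerSeries σ ℤ →+ (MvPowerSeries σ ℤ)⟦X⟧ where
  toFun f := PowerSeries.mk fun n => if hn : n ≠ 0 then expand n hn f else 0
  map_zero' := by
    ext1 n
    rw [PowerSeries.coeff_mk]
    split_ifs <;> simp
  map_add' f g := by
    ext1 n
    rw [map_add, PowerSeries.coeff_mk, PowerSeries.coeff_mk, PowerSeries.coeff_mk]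
    split_ifs <;> simp

theorem coeff_adamsSeries {n : ℕ} (hn : n ≠ 0) (f : MvPowerSeries σ ℤ) :
    PowerSeries.coeff n (adamsSeries f) = expand n hn f := by
  rw [adamsSeries, AddMonoidHom.coe_mk, ZeroHom.coe_mk, PowerSeries.coeff_mk, dif_pos hn]

theorem coeff_zero_adamsSeries (f : MvPowerSeries σ ℤ) :
    PowerSeries.coeff 0 (adamsSeries f) = 0 := by
  rw [adamsSeries, AddMonoidHom.coe_mk, ZeroHom.coe_mk, PowerSeries.coeff_mk, dif_neg (by simp)]

theorem AgreeBelow.adamsSeries {μ : σ →₀ ℕ} {f g : MvPowerSeries σ ℤ} (h : AgreeBelow μ f g)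
    (n : ℕ) : AgreeBelow μ (PowerSeries.coeff n f.adamsSeries)
      (PowerSeries.coeff n g.adamsSeries) := by
  rcases eq_or_ne n 0 with rfl | hn
  · rw [coeff_zero_adamsSeries, coeff_zero_adamsSeries]
    exact .refl _
  · rw [coeff_adamsSeries hn, coeff_adamsSeries hn]
    exact h.expand n hn

/-- `F` is a candidate for `λ_t(f)`: its logarithmic derivative is `∑ f(x^n) t^n`. -/
def IsLambdaSeries (f : MvPowerSeries σ ℤ) (F : (MvPowerSeries σ ℤ)⟦X⟧) : Prop :=
  PowerSeries.coeff 0 F = 1 ∧ PowerSeries.ghost F = adamsSeries f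

/-- By Newton's identities `n λ_n(f)` is a sum of products of `ψ_i(f)` with lower `λ_j(f)`;
products, `f ↦ f(x^i)` and cancellation of `n` all respect agreement below `μ`. Besides uniqueness,
this is the continuity that allows passing from polynomials to power series. -/
theorem IsLambdaSeries.agreeBelow {f g : MvPowerSeries σ ℤ} {F G : (MvPowerSeries σ ℤ)⟦X⟧}
    (hF : IsLambdaSeries f F) (hG : IsLambdaSeries g G) {μ : σ →₀ ℕ} (h : AgreeBelow μ f g)
    (n : ℕ) : AgreeBelow μ (PowerSeries.coeff n F) (PowerSeries.coeff n G) := by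
  induction n using Nat.strong_induction_on with
  | _ n ih =>
    rcases eq_or_ne n 0 with rfl | hn
    · rw [hF.1, hG.1]
      exact .refl _
    apply AgreeBelow.of_natCast_mul hn
    rw [PowerSeries.newton hF.1, PowerSeries.newton hG.1, hF.2, hG.2]
    refine .sum fun p hp => .mul (.refl _) ?_
    have hp' := Finset.HasAntidiagonal.mem_antidiagonal.1 hp
    rcases eq_or_ne p.1 0 with h0 | h0
    · rw [h0, coeff_zero_adamsSeries, coeff_zero_adamsSeries, zero_mul, zero_mul]
      exact .refl _
    · exact (h.adamsSeries _).mul (ih _ (by omega))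

theorem IsLambdaSeries.unique {f : MvPowerSeries σ ℤ} {F G : (MvPowerSeries σ ℤ)⟦X⟧}
    (hF : IsLambdaSeries f F) (hG : IsLambdaSeries f G) : F = G := by
  ext n m
  exact hF.agreeBelow hG (.refl f) n m le_rfl

theorem IsLambdaSeries.mul {f g : MvPowerSeries σ ℤ} {F G : (MvPowerSeries σ ℤ)⟦X⟧}
    (hF : IsLambdaSeries f F) (hG : IsLambdaSeries g G) : IsLambdaSeries (f + g) (F * G) :=
  ⟨PowerSeries.coeff_zero_mul_eq_one hF.1 hG.1, by
    rw [PowerSeries.ghost_mul hF.1 hG.1, hF.2, hG.2, map_add]⟩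

theorem isLambdaSeries_zero : IsLambdaSeries (0 : MvPowerSeries σ ℤ) 1 :=
  ⟨by simp, by rw [PowerSeries.ghost_one, map_zero]⟩

theorem isLambdaSeries_monomial (m : σ →₀ ℕ) :
    IsLambdaSeries (monomial m (1 : ℤ))
      (1 + PowerSeries.C (monomial m (1 : ℤ)) * PowerSeries.X) := by
  refine ⟨by simp, ?_⟩
  ext1 n
  rcases eq_or_ne n 0 with rfl | hn
  · rw [PowerSeries.coeff_zero_ghost, coeff_zero_adamsSeries]
  · rw [PowerSeries.coeff_ghost_one_add_C_mul_X _ hn, coeff_adamsSeries hn, expand_monomial,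
      monomial_pow, one_pow]

theorem isLambdaSeries_sum {ι : Type*} (s : Finset ι) (f : ι → MvPowerSeries σ ℤ)
    (F : ι → (MvPowerSeries σ ℤ)⟦X⟧) (h : ∀ i, IsLambdaSeries (f i) (F i)) :
    IsLambdaSeries (∑ i ∈ s, f i) (∏ i ∈ s, F i) := by
  classical
  induction s using Finset.induction_on with
  | empty => exact isLambdaSeries_zero
  | insert a s ha ih =>
    rw [Finset.sum_insert ha, Finset.prod_insert ha]
    exact (h a).mul ih

/-- The power series that have a `λ_t`. -/
def lambdaSubgroup (σ : Type*) : AddSubgroup (MvPowerSeries σ ℤ) where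
  carrier := {f | ∃ F, IsLambdaSeries f F}
  zero_mem' := ⟨1, isLambdaSeries_zero⟩
  add_mem' := by
    rintro f g ⟨F, hF⟩ ⟨G, hG⟩
    exact ⟨_, hF.mul hG⟩
  neg_mem' := by
    rintro f ⟨F, hF⟩
    have h : F * PowerSeries.invOfUnit F 1 = 1 := by
      apply PowerSeries.mul_invOfUnit
      rw [← PowerSeries.coeff_zero_eq_constantCoeff_apply, hF.1, Units.val_one]
    have h0 : PowerSeries.coeff 0 (PowerSeries.invOfUnit F 1) = 1 := by simp
    refine ⟨_, h0, ?_⟩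
    have h1 := PowerSeries.ghost_mul hF.1 h0
    rw [h, PowerSeries.ghost_one, hF.2] at h1
    rw [map_neg]
    exact eq_neg_of_add_eq_zero_right h1.symm

/-- This is where integrality comes from: the divisions by `n` in Newton's identities are exact for
monomials, where `λ_t` is explicit, and monomials generate the polynomials additively. -/
theorem coe_mem_lambdaSubgroup (p : MvPolynomial σ ℤ) :
    (p : MvPowerSeries σ ℤ) ∈ lambdaSubgroup σ := by
  induction p using MvPolynomial.induction_on' with
  | monomial u a =>
    have := (lambdaSubgroup σ).zsmul_mem ⟨_, isLambdaSeries_monomial u⟩ a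
    rwa [← map_zsmul, smul_eq_mul, mul_one, ← MvPolynomial.coe_monomial] at this
  | add p q hp hq =>
    rw [MvPolynomial.coe_add]
    exact add_mem hp hq

theorem agreeBelow_trunc' [DecidableEq σ] {μ ν : σ →₀ ℕ} (h : μ ≤ ν) (f : MvPowerSeries σ ℤ) :
    AgreeBelow μ f (trunc' ℤ ν f) := by
  intro κ hκ
  rw [MvPolynomial.coeff_coe, coeff_trunc', if_pos (hκ.trans h)]

/-- The coefficient of `λ_n(f)` at `μ` is read off from `λ_n` of the truncation of `f` at `μ`, a
polynomial. -/
theorem exists_isLambdaSeries (f : MvPowerSeries σ ℤ) : ∃ F, IsLambdaSeries f F := by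
  classical
  choose G hG using fun μ => coe_mem_lambdaSubgroup (trunc' ℤ μ f)
  let c : ℕ → MvPowerSeries σ ℤ := fun n μ => coeff μ (PowerSeries.coeff n (G μ))
  let F : (MvPowerSeries σ ℤ)⟦X⟧ := PowerSeries.mk c
  -- Truncations at `κ ≤ μ` and at `μ` agree below `κ`, so the diagonal choice of coefficients is
  -- consistent.
  have hF : ∀ n μ, AgreeBelow μ (PowerSeries.coeff n F) (PowerSeries.coeff n (G μ)) := by
    intro n μ κ hκ
    have h : coeff κ (PowerSeries.coeff n F) = coeff κ (PowerSeries.coeff n (G κ)) := by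
      rw [PowerSeries.coeff_mk]
      rfl
    rw [h]
    refine (hG κ).agreeBelow (hG μ) (fun ν hν => ?_) n κ le_rfl
    rw [← agreeBelow_trunc' le_rfl f ν hν, ← agreeBelow_trunc' hκ f ν hν]
  have h0 : PowerSeries.coeff 0 F = 1 := by
    ext μ
    rw [hF 0 μ μ le_rfl, (hG μ).1]
  refine ⟨F, h0, (PowerSeries.eq_ghost_of_newton h0 fun n => ?_).symm⟩
  ext μ
  have h1 : AgreeBelow μ (n * PowerSeries.coeff n F) (n * PowerSeries.coeff n (G μ)) :=
    .mul (.refl _) (hF n μ)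
  rw [h1 μ le_rfl, PowerSeries.newton (hG μ).1, (hG μ).2]
  symm
  refine AgreeBelow.sum (μ := μ) (fun p _ => .mul (.refl _) (.mul ?_ (hF _ μ))) μ le_rfl
  exact (agreeBelow_trunc' le_rfl f).adamsSeries _

/-- The `λ`-structure on power series with integer coefficients in which all monomials have
rank one. -/
noncomputable def lambdaStructure (σ : Type*) : LambdaStructure (MvPowerSeries σ ℤ) where
  series f := (exists_isLambdaSeries f).choose
  coeff_zero f := (exists_isLambdaSeries f).choose_spec.1
  coeff_one f := by
    have h := (exists_isLambdaSeries f).choose_spec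
    have := PowerSeries.newton h.1 1
    rw [Finset.Nat.antidiagonal_succ] at this
    simpa [h.1, h.2, coeff_zero_adamsSeries, coeff_adamsSeries] using this
  series_add f g := (exists_isLambdaSeries (f + g)).choose_spec.unique
    ((exists_isLambdaSeries f).choose_spec.mul (exists_isLambdaSeries g).choose_spec)

theorem isLambdaSeries_series (f : MvPowerSeries σ ℤ) :
    IsLambdaSeries f ((lambdaStructure σ).series f) :=
  (exists_isLambdaSeries f).choose_spec

theorem adams_lambdaStructure {n : ℕ} (hn : n ≠ 0) (f : MvPowerSeries σ ℤ) :
    (lambdaStructure σ).adams n f = expand n hn f := by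
  rw [LambdaStructure.adams_eq, (isLambdaSeries_series f).2, coeff_adamsSeries hn]

end AdamsSeries

end MvPowerSeries

/-! ### The `λ`-structure on invariant power series -/

section InvariantsLambda

open MvPowerSeries

variable {σ : Type*} (w : σ → ℕ)

instance : IsDomain (MvPowerSeries σ ℤ) := NoZeroDivisors.to_isDomain _

instance : IsDomain (boundedInvariants w) := NoZeroDivisors.to_isDomain _

instance : CharZero (boundedInvariants w) where
  cast_injective a b h := by
    have h' : constantCoeff ((a : boundedInvariants w) : MvPowerSeries σ ℤ) =
        constantCoeff ((b : boundedInvariants w) : MvPowerSeries σ ℤ) := by rw [h]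
    simpa using h'

theorem expand_mem_boundedInvariants {f : MvPowerSeries σ ℤ} (hf : f ∈ boundedInvariants w)
    (n : ℕ) (hn : n ≠ 0) : f.expand n hn ∈ boundedInvariants w := by
  obtain ⟨⟨N, hN⟩, hinv⟩ := hf
  refine ⟨⟨n * N, fun m hm => ?_⟩, fun g hg => ?_⟩
  · rcases coeff_expand_cases n hn m with ⟨k, rfl, hk⟩ | h0
    · rw [map_nsmul, smul_eq_mul]
      exact Nat.mul_le_mul_left _ (hN k (by rwa [hk] at hm))
    · exact absurd (h0 f) hm
  · conv_rhs => rw [← hinv g hg]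
    exact (expand_rename n hn g f).symm

theorem mem_boundedInvariants_of_nsmul {f : MvPowerSeries σ ℤ} {n : ℕ} (hn : n ≠ 0)
    (hf : n • f ∈ boundedInvariants w) : f ∈ boundedInvariants w := by
  obtain ⟨⟨N, hN⟩, hinv⟩ := hf
  refine ⟨⟨N, fun m hm => hN m ?_⟩, fun g hg => ?_⟩
  · rw [map_nsmul]
    exact smul_ne_zero hn hm
  · have h := hinv g hg
    rw [map_nsmul] at h
    ext m
    have h' := congrArg (coeff m) h
    rw [map_nsmul, map_nsmul] at h'
    exact nsmul_right_injective hn h'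

/-- Newton's identities put `n λ_n(f)` in the subring by induction, and the factor `n` cancels
because both defining conditions are saturated over ℤ. -/
theorem lam_mem_boundedInvariants {f : MvPowerSeries σ ℤ} (hf : f ∈ boundedInvariants w) (n : ℕ) :
    (lambdaStructure σ).lam n f ∈ boundedInvariants w := by
  induction n using Nat.strong_induction_on with
  | _ n ih =>
    rcases eq_or_ne n 0 with rfl | hn
    · rw [LambdaStructure.lam_zero]
      exact one_mem _
    apply mem_boundedInvariants_of_nsmul w hn
    rw [nsmul_eq_mul, LambdaStructure.newton]
    refine sum_mem fun p hp => mul_mem (pow_mem (neg_mem (one_mem _)) _) ?_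
    have hp' := Finset.HasAntidiagonal.mem_antidiagonal.1 hp
    rcases eq_or_ne p.1 0 with h0 | h0
    · rw [h0, LambdaStructure.adams_zero, zero_mul]
      exact zero_mem _
    · rw [adams_lambdaStructure h0]
      exact mul_mem (expand_mem_boundedInvariants w hf _ h0) (ih _ (by omega))

namespace boundedInvariants

/-- The `λ`-structure on invariant power series in which `λ_t` of a monomial `m` is `1 + m t`. -/
noncomputable def lambdaStructure : LambdaStructure (boundedInvariants w) where
  series f := PowerSeries.mk fun n =>
    ⟨(MvPowerSeries.lambdaStructure σ).lam n f, lam_mem_boundedInvariants w f.2 n⟩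
  coeff_zero f := by
    rw [PowerSeries.coeff_mk]
    exact Subtype.ext (LambdaStructure.lam_zero _ _)
  coeff_one f := by
    rw [PowerSeries.coeff_mk]
    exact Subtype.ext (LambdaStructure.lam_one _ _)
  series_add f g := by
    apply PowerSeries.map_injective (boundedInvariants w).subtype Subtype.val_injective
    have h : ∀ f : boundedInvariants w, PowerSeries.map (boundedInvariants w).subtype
        (PowerSeries.mk fun n => ⟨(MvPowerSeries.lambdaStructure σ).lam n f,
          lam_mem_boundedInvariants w f.2 n⟩) = (MvPowerSeries.lambdaStructure σ).series f :=
      fun f => by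
        ext1 n
        rw [PowerSeries.coeff_map, PowerSeries.coeff_mk]
        rfl
    rw [map_mul, h, h, h]
    exact (MvPowerSeries.lambdaStructure σ).series_add f g

theorem map_series (f : boundedInvariants w) :
    PowerSeries.map (boundedInvariants w).subtype ((lambdaStructure w).series f) =
      (MvPowerSeries.lambdaStructure σ).series f := by
  ext1 n
  rw [PowerSeries.coeff_map, lambdaStructure, PowerSeries.coeff_mk]
  rfl

theorem coe_lam (n : ℕ) (f : boundedInvariants w) :
    ((lambdaStructure w).lam n f : MvPowerSeries σ ℤ) =
      (MvPowerSeries.lambdaStructure σ).lam n f := by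
  rw [LambdaStructure.lam, LambdaStructure.lam, ← map_series, PowerSeries.coeff_map]
  rfl

theorem coe_adams {n : ℕ} (hn : n ≠ 0) (f : boundedInvariants w) :
    ((lambdaStructure w).adams n f : MvPowerSeries σ ℤ) = expand n hn f := by
  rw [← adams_lambdaStructure hn, LambdaStructure.adams_eq, LambdaStructure.adams_eq, ← map_series,
    ← PowerSeries.map_ghost _ ((lambdaStructure w).coeff_zero f), PowerSeries.coeff_map]
  rfl

/-- The Adams operations as ring homomorphisms. -/
noncomputable def adamsHom (n : ℕ) : boundedInvariants w →+* boundedInvariants w :=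
  if hn : n ≠ 0 then
    RingHom.codRestrict ((expand n hn).toRingHom.comp (boundedInvariants w).subtype) _
      fun f => expand_mem_boundedInvariants w f.2 n hn
  else RingHom.id _

theorem coe_adamsHom {n : ℕ} (hn : n ≠ 0) (f : boundedInvariants w) :
    (adamsHom w n f : MvPowerSeries σ ℤ) = expand n hn f := by
  rw [adamsHom, dif_pos hn]
  rfl

theorem isSpecial : (lambdaStructure w).IsSpecial := by
  refine LambdaStructure.isSpecial_of_adams (adamsHom w) (fun n hn r => Subtype.ext ?_)
    fun m n hm hn r => Subtype.ext ?_
  · rw [coe_adams w hn, coe_adamsHom w hn]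
  · rw [coe_adamsHom w hm, coe_adamsHom w hn, coe_adamsHom w (Nat.mul_ne_zero hm hn), expand_mul]

theorem mem_homogeneousPart_of_nsmul {f : boundedInvariants w} {n d : ℕ} (hn : n ≠ 0)
    (hf : n • f ∈ homogeneousPart w d) : f ∈ homogeneousPart w d := by
  intro m hm
  refine hf m ?_
  have : ((n • f : boundedInvariants w) : MvPowerSeries σ ℤ) = n • (f : MvPowerSeries σ ℤ) := rfl
  rw [this, map_nsmul]
  exact smul_ne_zero hn hm

/-- Each Newton term `ψ_i(f) λ_{n-i}(f)` has degree `i d + (n - i) d = n d`, and `n` cancels as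
before. -/
theorem isGraded : (lambdaStructure w).IsGraded (homogeneousPart w) := by
  intro n d f hf
  induction n using Nat.strong_induction_on with
  | _ n ih =>
    rcases eq_or_ne n 0 with rfl | hn
    · rw [LambdaStructure.lam_zero, zero_mul]
      exact SetLike.one_mem_graded _
    apply mem_homogeneousPart_of_nsmul w hn
    rw [nsmul_eq_mul, LambdaStructure.newton]
    refine sum_mem fun p hp => ?_
    have hp' := Finset.HasAntidiagonal.mem_antidiagonal.1 hp
    rcases eq_or_ne p.1 0 with h0 | h0
    · rw [h0, LambdaStructure.adams_zero, zero_mul, mul_zero]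
      exact zero_mem _
    · have h1 : (lambdaStructure w).adams p.1 f ∈ homogeneousPart w (p.1 * d) := by
        intro m hm
        rw [coe_adams w h0] at hm
        rcases coeff_expand_cases p.1 h0 m with ⟨k, rfl, hk⟩ | h0
        · rw [map_nsmul, smul_eq_mul, hf k (by rwa [hk] at hm)]
        · exact absurd (h0 _) hm
      have h2 := SetLike.mul_mem_graded h1 (ih p.2 (by omega))
      rw [← add_mul, hp'] at h2
      rcases neg_one_pow_eq_or (boundedInvariants w) (p.1 + 1) with h3 | h3
      · rwa [h3, one_mul]
      · rw [h3, neg_one_mul]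
        exact neg_mem h2

end boundedInvariants

end InvariantsLambda

/-! ### Leading monomials -/

namespace PolySymFun

open MvPowerSeries

/-- The sum of the second indices of the variables of a monomial. -/
noncomputable abbrev cost : (ℕ+ × ℕ+ →₀ ℕ) →+ ℕ := Finsupp.weight fun p => (p.2 : ℕ)

/-- The degree of a monomial. -/
noncomputable abbrev deg : (ℕ+ × ℕ+ →₀ ℕ) →+ ℕ := Finsupp.weight fun p => (p.1 : ℕ)

/-- `m` is the only monomial of minimal cost in `f`, and its coefficient is one. -/
def HasLead (f : MvPowerSeries (ℕ+ × ℕ+) ℤ) (m : ℕ+ × ℕ+ →₀ ℕ) : Prop :=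
  coeff m f = 1 ∧ ∀ m', coeff m' f ≠ 0 → m' = m ∨ cost m < cost m'

theorem hasLead_one : HasLead 1 0 := by
  classical
  refine ⟨by simp, fun m' h => Or.inl ?_⟩
  by_contra h'
  rw [MvPowerSeries.coeff_one, if_neg h'] at h
  exact h rfl

/-- Cost is additive, so replacing either factor by a non-leading monomial strictly raises the
total. -/
theorem HasLead.mul {f g : MvPowerSeries (ℕ+ × ℕ+) ℤ} {m n : ℕ+ × ℕ+ →₀ ℕ}
    (hf : HasLead f m) (hg : HasLead g n) : HasLead (f * g) (m + n) := by
  classical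
  constructor
  · rw [coeff_mul, Finset.sum_eq_single_of_mem (m, n)
      (Finset.HasAntidiagonal.mem_antidiagonal.2 rfl), hf.1, hg.1, one_mul]
    rintro ⟨p, q⟩ hpq hne
    by_contra h
    have hpq' := congrArg cost (Finset.HasAntidiagonal.mem_antidiagonal.1 hpq)
    rw [map_add, map_add] at hpq'
    rcases hf.2 p (left_ne_zero_of_mul h) with rfl | hp
    · rcases hg.2 q (right_ne_zero_of_mul h) with rfl | hq
      · exact hne rfl
      · dsimp only at hpq'
        omega
    · rcases hg.2 q (right_ne_zero_of_mul h) with rfl | hq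
      · dsimp only at hpq'
        omega
      · dsimp only at hpq'
        omega
  · intro m' h
    rw [coeff_mul] at h
    obtain ⟨⟨p, q⟩, hpq, hne⟩ := Finset.exists_ne_zero_of_sum_ne_zero h
    rw [← Finset.HasAntidiagonal.mem_antidiagonal.1 hpq, map_add, map_add]
    rcases hf.2 p (left_ne_zero_of_mul hne) with rfl | hp
    · rcases hg.2 q (right_ne_zero_of_mul hne) with rfl | hq
      · exact Or.inl rfl
      · right; dsimp only; omega
    · rcases hg.2 q (right_ne_zero_of_mul hne) with rfl | hq
      · right; dsimp only; omega
      · right; dsimp only; omega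

theorem HasLead.pow {f : MvPowerSeries (ℕ+ × ℕ+) ℤ} {m : ℕ+ × ℕ+ →₀ ℕ}
    (hf : HasLead f m) (k : ℕ) : HasLead (f ^ k) (k • m) := by
  induction k with
  | zero => rw [pow_zero, zero_smul]; exact hasLead_one
  | succ k ih => rw [pow_succ, succ_nsmul]; exact ih.mul hf

theorem HasLead.prod {ι : Type*} (s : Finset ι) {f : ι → MvPowerSeries (ℕ+ × ℕ+) ℤ}
    {m : ι → ℕ+ × ℕ+ →₀ ℕ} (h : ∀ i, HasLead (f i) (m i)) :
    HasLead (∏ i ∈ s, f i) (∑ i ∈ s, m i) := by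
  classical
  induction s using Finset.induction_on with
  | empty => exact hasLead_one
  | insert a s ha ih =>
    rw [Finset.prod_insert ha, Finset.sum_insert ha]
    exact (h a).mul ih

/-- The squarefree monomial `∏_{j ∈ T} x_{ij}`. -/
noncomputable def ind (i : ℕ+) (T : Finset ℕ+) : ℕ+ × ℕ+ →₀ ℕ :=
  ∑ j ∈ T, Finsupp.single (i, j) 1

theorem ind_apply (i : ℕ+) (T : Finset ℕ+) (p : ℕ+ × ℕ+) :
    ind i T p = if p.1 = i ∧ p.2 ∈ T then 1 else 0 := by
  classical
  obtain ⟨a, b⟩ := p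
  rw [ind, Finsupp.finsetSum_apply]
  simp only [Finsupp.single_apply, Prod.mk.injEq, eq_comm (a := i)]
  by_cases h : a = i <;> simp [h]

theorem ind_injective (i : ℕ+) : Function.Injective (ind i) := by
  intro T T' h
  ext j
  have := DFunLike.congr_fun h (i, j)
  rw [ind_apply, ind_apply] at this
  by_cases h1 : j ∈ T <;> by_cases h2 : j ∈ T' <;> simp_all

theorem deg_ind (i : ℕ+) (T : Finset ℕ+) : deg (ind i T) = i * T.card := by
  rw [ind, map_sum]
  simp [Finsupp.weight_single, mul_comm]

theorem cost_ind (i : ℕ+) (T : Finset ℕ+) : cost (ind i T) = ∑ j ∈ T, (j : ℕ) := by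
  rw [ind, map_sum]
  simp [Finsupp.weight_single]

/-- Exchange argument: the elements of `T` outside `[1, j]` are at least `j + 1`, while the equally
many elements of `[1, j]` missing from `T` are at most `j`. -/
theorem sum_Icc_lt_sum {T : Finset ℕ+} {j : ℕ+} (hT : T.card = j) (hne : T ≠ Finset.Icc 1 j) :
    ∑ a ∈ Finset.Icc 1 j, (a : ℕ) < ∑ a ∈ T, (a : ℕ) := by
  set I := Finset.Icc 1 j
  have hI : I.card = j := by simp [I, PNat.card_Icc]
  have hc : (I \ T).card = (T \ I).card := Finset.card_sdiff_comm (hI.trans hT.symm)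
  have hpos : 0 < (T \ I).card := by
    rw [Finset.card_pos, Finset.sdiff_nonempty]
    intro h
    exact hne (Finset.eq_of_subset_of_card_le h (by omega))
  have h1 : ∑ a ∈ I \ T, (a : ℕ) ≤ (I \ T).card • (j : ℕ) := by
    refine Finset.sum_le_card_nsmul _ _ _ fun a ha => ?_
    exact (Finset.mem_Icc.1 (Finset.mem_sdiff.1 ha).1).2
  have h2 : (T \ I).card • ((j : ℕ) + 1) ≤ ∑ a ∈ T \ I, (a : ℕ) := by
    refine Finset.card_nsmul_le_sum _ _ _ fun a ha => ?_
    have h := (Finset.mem_sdiff.1 ha).2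
    simp only [I, Finset.mem_Icc, one_le, true_and, not_le] at h
    exact h
  have h3 := Finset.sum_sdiff_sub_sum_sdiff (s₁ := I) (s₂ := T) (f := fun a => ((a : ℕ) : ℤ))
  rw [smul_eq_mul] at h1 h2
  rw [hc] at h1
  zify at *
  nlinarith

/-! ### Elementary polysymmetric functions -/

/-- The `λ`-structure on `PS`. -/
noncomputable abbrev lambdaStructure : LambdaStructure PolySymFun :=
  boundedInvariants.lambdaStructure _

/-- The elementary symmetric function of degree `p.2` in the variables `x_{p.1,*}`. -/
noncomputable def elem (p : ℕ+ × ℕ+) : PolySymFun := lambdaStructure.lam p.2 (M p.1)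

/-- Below `m` the infinite sum `M_i` agrees with the finite sum over `S`, whose `λ_t` is `∏ (1 +
x_{ij} t)`. -/
theorem coeff_lam_sumVars (i : ℕ+) (n : ℕ) (m : ℕ+ × ℕ+ →₀ ℕ) (S : Finset ℕ+)
    (hS : ∀ j, m (i, j) ≠ 0 → j ∈ S) :
    coeff m ((MvPowerSeries.lambdaStructure _).lam n (sumVars i)) =
      ∑ T ∈ Finset.powersetCard n S, if m = ind i T then 1 else 0 := by
  classical
  have h1 := isLambdaSeries_sum S (fun j => monomial (Finsupp.single (i, j) 1) (1 : ℤ)) _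
    fun j => isLambdaSeries_monomial _
  have h2 : AgreeBelow m (sumVars i)
      (∑ j ∈ S, monomial (Finsupp.single (i, j) 1) (1 : ℤ)) := by
    intro κ hκ
    rw [coeff_sumVars, map_sum]
    simp only [coeff_monomial]
    split_ifs with h
    · obtain ⟨j, rfl⟩ := h
      rw [Finset.sum_eq_single_of_mem j, if_pos rfl]
      · apply hS
        have := hκ (i, j)
        rw [Finsupp.single_eq_same] at this
        omega
      · intro b _ hb
        rw [if_neg]
        intro h
        have := (Finsupp.single_left_inj one_ne_zero).1 h
        exact hb (Prod.ext_iff.1 this).2.symm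
    · rw [Finset.sum_eq_zero]
      intro j _
      rw [if_neg fun h' => h ⟨j, h'⟩]
  rw [LambdaStructure.lam, (isLambdaSeries_series _).agreeBelow h1 h2 n m le_rfl,
    PowerSeries.coeff_prod_one_add_C_mul_X, map_sum]
  refine Finset.sum_congr rfl fun T _ => ?_
  have : ∏ j ∈ T, monomial (Finsupp.single (i, j) 1) (1 : ℤ) = monomial (ind i T) (1 : ℤ) := by
    rw [prod_monomial, Finset.prod_const_one, ind]
  rw [this, coeff_monomial]

theorem hasLead_elem (p : ℕ+ × ℕ+) : HasLead (elem p) (ind p.1 (Finset.Icc 1 p.2)) := by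
  classical
  rw [elem, boundedInvariants.coe_lam]
  change HasLead ((MvPowerSeries.lambdaStructure _).lam p.2 (sumVars p.1)) _
  constructor
  · rw [coeff_lam_sumVars p.1 p.2 _ (Finset.Icc 1 p.2) (fun j hj => ?_), Finset.powersetCard_eq_filter]
    · rw [Finset.sum_eq_single_of_mem (Finset.Icc 1 p.2), if_pos rfl]
      · simp [PNat.card_Icc]
      · intro T _ hT
        rw [if_neg fun h => hT (ind_injective _ h).symm]
    · rw [ind_apply] at hj
      simp_all
  · intro m hm
    rw [coeff_lam_sumVars p.1 p.2 m (m.support.image Prod.snd) (fun j hj => ?_)] at hm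
    · obtain ⟨T, hT, hne⟩ := Finset.exists_ne_zero_of_sum_ne_zero hm
      obtain rfl : m = ind p.1 T := by
        by_contra h
        rw [if_neg h] at hne
        exact hne rfl
      by_cases h : T = Finset.Icc 1 p.2
      · exact Or.inl (by rw [h])
      · right
        rw [cost_ind, cost_ind]
        exact sum_Icc_lt_sum (Finset.mem_powersetCard.1 hT).2 h
    · exact Finset.mem_image_of_mem Prod.snd (Finsupp.mem_support_iff.2 hj)

/-- The leading monomial of a monomial in the elementary polysymmetric functions. -/
noncomputable def lead : (ℕ+ × ℕ+ →₀ ℕ) →ₗ[ℕ] (ℕ+ × ℕ+ →₀ ℕ) :=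
  Finsupp.linearCombination ℕ fun p => ind p.1 (Finset.Icc 1 p.2)

theorem hasLead_prod (a : ℕ+ × ℕ+ →₀ ℕ) :
    HasLead ((a.prod fun p k => elem p ^ k : PolySymFun) : MvPowerSeries _ ℤ) (lead a) := by
  have h := HasLead.prod a.support fun p => (hasLead_elem p).pow (a p)
  have h1 : ((a.prod fun p k => elem p ^ k : PolySymFun) : MvPowerSeries (ℕ+ × ℕ+) ℤ) =
      ∏ p ∈ a.support, (elem p : MvPowerSeries (ℕ+ × ℕ+) ℤ) ^ a p := by
    rw [Finsupp.prod]
    push_cast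
    rfl
  rw [h1]
  exact h

/-- The factor `e_{ib}` contributes to the exponent of `x_{ij}` exactly when `j ≤ b`. The exponents
of `lead a` are thus tail sums of `a`, and `a` is recovered by successive differences. -/
theorem lead_apply (a : ℕ+ × ℕ+ →₀ ℕ) (i j : ℕ+) :
    lead a (i, j) = lead a (i, j + 1) + a (i, j) := by
  classical
  induction a using Finsupp.induction_linear with
  | zero => simp
  | add a b ha hb => simp only [map_add, Finsupp.add_apply, ha, hb]; ring
  | single p k =>
    obtain ⟨a, b⟩ := p
    rw [lead, Finsupp.linearCombination_single, Finsupp.smul_apply, Finsupp.smul_apply, ind_apply,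
      ind_apply, Finsupp.single_apply]
    simp only [Finset.mem_Icc, one_le, true_and, Prod.mk.injEq, eq_comm (a := i),
      PNat.add_one_le_iff, le_iff_lt_or_eq (a := j)]
    by_cases h1 : a = i <;> by_cases h2 : j < b <;> by_cases h3 : j = b <;> simp_all [eq_comm]

theorem lead_injective : Function.Injective lead := by
  intro a b h
  ext ⟨i, j⟩
  have h1 := lead_apply a i j
  rw [h, lead_apply b] at h1
  omega

theorem deg_lead (a : ℕ+ × ℕ+ →₀ ℕ) :
    deg (lead a) = Finsupp.weight (fun p : ℕ+ × ℕ+ => (p.1 : ℕ) * p.2) a := by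
  induction a using Finsupp.induction_linear with
  | zero => simp
  | add a b ha hb => rw [map_add, map_add, map_add, ha, hb]
  | single p k =>
    rw [lead, Finsupp.linearCombination_single, map_nsmul, deg_ind, Finsupp.weight_single]
    simp [PNat.card_Icc]

/-- The witness is the difference `m(i,j) - m(i,j+1)`; monotonicity makes the truncated subtraction
exact. -/
theorem exists_lead_eq {m : ℕ+ × ℕ+ →₀ ℕ}
    (hm : ∀ i j j', j ≤ j' → m (i, j') ≤ m (i, j)) : ∃ a, lead a = m := by
  classical
  let a : ℕ+ × ℕ+ →₀ ℕ := Finsupp.onFinset m.support (fun p => m p - m (p.1, p.2 + 1))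
    fun p hp => by rw [Finsupp.mem_support_iff]; omega
  have ha : ∀ p, a p = m p - m (p.1, p.2 + 1) := fun _ => rfl
  refine ⟨a, ?_⟩
  let N : ℕ := ∑ p ∈ m.support ∪ (lead a).support, (p.2 : ℕ)
  have hN : ∀ p ∈ m.support ∪ (lead a).support, (p.2 : ℕ) ≤ N := fun p hp =>
    Finset.single_le_sum (f := fun p : ℕ+ × ℕ+ => (p.2 : ℕ)) (fun _ _ => Nat.zero_le _) hp
  -- Downward induction on `j`, starting beyond `N`, where both sides vanish.
  have key : ∀ (k : ℕ) (i j : ℕ+), N < j + k → lead a (i, j) = m (i, j) := by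
    intro k
    induction k with
    | zero =>
      intro i j hj
      have h : (i, j) ∉ m.support ∪ (lead a).support := fun h => by
        have := hN _ h
        simp only at this
        omega
      rw [Finset.mem_union, Finsupp.mem_support_iff, Finsupp.mem_support_iff] at h
      push Not at h
      rw [h.1, h.2]
    | succ k ih =>
      intro i j hj
      rw [lead_apply, ih i (j + 1) (by rw [PNat.add_coe, PNat.one_coe]; omega), ha]
      have := hm i j (j + 1) (PNat.lt_add_right j 1).le
      simp only
      omega
  ext ⟨i, j⟩
  exact key (N + 1) i j (by omega)

/-! ### The fundamental theorem for polysymmetric functions -/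

theorem aeval_elem (P : MvPolynomial (ℕ+ × ℕ+) ℤ) :
    MvPolynomial.aeval elem P = ∑ a ∈ P.support, P.coeff a • a.prod fun p k => elem p ^ k := by
  rw [MvPolynomial.aeval_def, MvPolynomial.eval₂_eq]
  refine Finset.sum_congr rfl fun a _ => ?_
  rw [zsmul_eq_mul]
  rfl

theorem coeff_coe_sum_zsmul {ι : Type*} (s : Finset ι) (c : ι → ℤ) (f : ι → PolySymFun)
    (m : ℕ+ × ℕ+ →₀ ℕ) :
    coeff m ((∑ a ∈ s, c a • f a : PolySymFun) : MvPowerSeries _ ℤ) =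
      ∑ a ∈ s, c a * coeff m (f a : MvPowerSeries _ ℤ) := by
  have h := map_sum PolySymFun.subtype (fun a => c a • f a) s
  have h1 : ((∑ a ∈ s, c a • f a : PolySymFun) : MvPowerSeries (ℕ+ × ℕ+) ℤ) =
    ∑ a ∈ s, c a • (f a : MvPowerSeries (ℕ+ × ℕ+) ℤ) := by
    rw [← Subring.subtype_apply, h]
    simp
  rw [h1, map_sum]
  exact Finset.sum_congr rfl fun a _ => by rw [map_zsmul, smul_eq_mul]

/-- The term of `P` with cheapest leading monomial cannot be cancelled: the other leading monomials
are different and no cheaper. -/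
theorem aeval_elem_injective :
    Function.Injective (MvPolynomial.aeval (R := ℤ) elem) := by
  rw [injective_iff_map_eq_zero]
  intro P hP
  by_contra hne
  obtain ⟨a, ha, hmin⟩ := Finset.exists_min_image P.support (fun a => cost (lead a))
    (Finset.nonempty_iff_ne_empty.2 (by simpa using hne))
  have h : coeff (lead a) ((MvPolynomial.aeval elem P : PolySymFun) : MvPowerSeries _ ℤ) =
      coeff (lead a) ((0 : PolySymFun) : MvPowerSeries _ ℤ) := by rw [hP]
  rw [aeval_elem, coeff_coe_sum_zsmul, Finset.sum_eq_single_of_mem a ha, (hasLead_prod a).1,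
    mul_one] at h
  · exact (MvPolynomial.mem_support_iff.1 ha) (h.trans rfl)
  · intro b hb hba
    by_contra h'
    rcases (hasLead_prod b).2 _ (right_ne_zero_of_mul h') with h1 | h1
    · exact hba (lead_injective h1).symm
    · exact absurd (hmin b hb) (not_le.2 h1)

/-- A degree alone allows infinitely many monomials; fixing the cost too bounds the second indices,
so each correction in the subtraction algorithm is a finite sum. -/
theorem finite_setOf_deg_cost (d c : ℕ) : {m | deg m = d ∧ cost m = c}.Finite := by
  classical
  let s : Finset (ℕ+ × ℕ+) :=
    Finset.Icc 1 (Nat.succPNat d) ×ˢ Finset.Icc 1 (Nat.succPNat c)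
  refine (Set.finite_Iic (∑ p ∈ s, Finsupp.single p d)).subset ?_
  rintro m ⟨hd, hc⟩ p
  rcases eq_or_ne (m p) 0 with h | h
  · rw [h]; exact Nat.zero_le _
  have h1 : (p.1 : ℕ) ≤ d := hd ▸ Finsupp.le_weight_of_ne_zero' (fun p : ℕ+ × ℕ+ => (p.1 : ℕ)) h
  have h2 : (p.2 : ℕ) ≤ c := hc ▸ Finsupp.le_weight_of_ne_zero' (fun p : ℕ+ × ℕ+ => (p.2 : ℕ)) h
  have h3 : m p ≤ d := hd ▸ Finsupp.le_weight (fun p : ℕ+ × ℕ+ => (p.1 : ℕ)) (PNat.ne_zero p.1) m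
  rw [Finsupp.finsetSum_apply, Finset.sum_eq_single_of_mem p, Finsupp.single_eq_same]
  · exact h3
  · simp only [s, Finset.mem_product, Finset.mem_Icc, one_le, true_and]
    exact ⟨PNat.coe_le_coe _ _ |>.1 (h1.trans (Nat.le_succ _)),
      PNat.coe_le_coe _ _ |>.1 (h2.trans (Nat.le_succ _))⟩
  · intro q _ hq
    rw [Finsupp.single_eq_of_ne hq.symm]

/-- If `j < j'` but `m(i,j) < m(i,j')`, exchanging `x_{ij}` and `x_{ij'}` gives a monomial of `f`
with the same coefficient and lower cost. -/
theorem antitone_of_cost_min {f : PolySymFun} {m : ℕ+ × ℕ+ →₀ ℕ}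
    (hm : coeff m (f : MvPowerSeries _ ℤ) ≠ 0)
    (hmin : ∀ m', coeff m' (f : MvPowerSeries _ ℤ) ≠ 0 → cost m ≤ cost m') (i j j' : ℕ+)
    (hj : j ≤ j') : m (i, j') ≤ m (i, j) := by
  classical
  rcases hj.eq_or_lt with rfl | hj
  · exact le_rfl
  by_contra! hlt
  set p : ℕ+ × ℕ+ := (i, j)
  set q : ℕ+ × ℕ+ := (i, j')
  have hpq : p ≠ q := fun h => hj.ne (Prod.ext_iff.1 h).2
  let g := Equiv.swap p q
  let r := (m.erase p).erase q
  have hr : m = r + Finsupp.single p (m p) + Finsupp.single q (m q) := by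
    have h1 : (m.erase p) q = m q := Finsupp.erase_ne hpq.symm
    have h2 := Finsupp.erase_add_single q (m.erase p)
    rw [h1] at h2
    have h3 := Finsupp.erase_add_single p m
    rw [← h2] at h3
    conv_lhs => rw [← h3]
    rw [add_right_comm]
  have hgr : Finsupp.mapDomain g r = r := by
    conv_rhs => rw [← Finsupp.mapDomain_id (v := r)]
    refine Finsupp.mapDomain_congr fun x hx => ?_
    rw [Finsupp.mem_support_iff] at hx
    refine Equiv.swap_apply_of_ne_of_ne ?_ ?_
    · rintro rfl
      rw [Finsupp.erase_ne hpq, Finsupp.erase_same] at hx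
      exact hx rfl
    · rintro rfl
      rw [Finsupp.erase_same] at hx
      exact hx rfl
  have hgm : Finsupp.mapDomain g m = r + Finsupp.single q (m p) + Finsupp.single p (m q) := by
    conv_lhs => rw [hr]
    rw [Finsupp.mapDomain_add, Finsupp.mapDomain_add, hgr, Finsupp.mapDomain_single,
      Finsupp.mapDomain_single, Equiv.swap_apply_left, Equiv.swap_apply_right]
  have hg : ∀ s, ((g s).1 : ℕ) = s.1 := by
    intro s
    by_cases h1 : s = p
    · subst h1
      simp only [g, Equiv.swap_apply_left, q, p]
    · by_cases h2 : s = q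
      · subst h2
        simp only [g, Equiv.swap_apply_right, q, p]
      · simp only [g, Equiv.swap_apply_of_ne_of_ne h1 h2]
  have hcoeff := (renameEquiv_eq_iff g f.1).1 (f.2.2 g hg) m
  have h := hmin (Finsupp.mapDomain g m) (by rw [hcoeff]; exact hm)
  have hc1 : cost m = cost r + m p * j + m q * j' := by
    conv_lhs => rw [hr]
    simp [Finsupp.weight_single, p, q]
  rw [hgm, hc1, map_add, map_add, Finsupp.weight_single, Finsupp.weight_single, smul_eq_mul,
    smul_eq_mul] at h
  have hj' : (j : ℕ) < j' := hj
  simp only [p, q] at h hlt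
  nlinarith

/-- If `x_{ij}` divides `m`, so do `x_{i1}, …, x_{ij}`, whence `j ≤ deg m`; the number of factors is
also at most `deg m`. -/
theorem cost_le_of_antitone {m : ℕ+ × ℕ+ →₀ ℕ}
    (hm : ∀ i j j', j ≤ j' → m (i, j') ≤ m (i, j)) : cost m ≤ deg m * deg m := by
  have h1 : ∀ p ∈ m.support, (p.2 : ℕ) ≤ deg m := by
    rintro ⟨i, j⟩ hp
    have hle : ind i (Finset.Icc 1 j) ≤ m := by
      rintro ⟨i', j'⟩
      rw [ind_apply]
      split_ifs with h
      · obtain ⟨rfl, h⟩ := h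
        have := hm i' j' j (Finset.mem_Icc.1 h).2
        rw [Finsupp.mem_support_iff] at hp
        exact (Nat.one_le_iff_ne_zero.2 hp).trans this
      · exact Nat.zero_le _
    obtain ⟨r, rfl⟩ := le_iff_exists_add.1 hle
    rw [map_add, deg_ind]
    simp only [PNat.card_Icc, PNat.one_coe, Nat.add_sub_cancel]
    exact (Nat.le_mul_of_pos_left _ i.pos).trans (Nat.le_add_right _ _)
  have h2 : cost m ≤ deg m * ∑ p ∈ m.support, m p := by
    rw [Finsupp.weight_apply, Finsupp.sum, Finset.mul_sum]
    refine Finset.sum_le_sum fun p hp => ?_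
    rw [smul_eq_mul, mul_comm]
    exact Nat.mul_le_mul_right _ (h1 p hp)
  refine h2.trans (Nat.mul_le_mul_left _ ?_)
  rw [Finsupp.weight_apply, Finsupp.sum]
  refine Finset.sum_le_sum fun p _ => ?_
  exact Nat.le_mul_of_pos_right _ p.1.pos

theorem elem_mem (p : ℕ+ × ℕ+) : elem p ∈ grading (p.1 * p.2) := by
  have := boundedInvariants.isGraded _ p.2 p.1 _ (M_mem p.1)
  rwa [mul_comm] at this

theorem prod_elem_mem {R : Type*} [CommRing R] {𝒜 : ℕ → AddSubgroup R} [SetLike.GradedMonoid 𝒜]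
    {e : ℕ+ × ℕ+ → R} (he : ∀ p, e p ∈ 𝒜 (p.1 * p.2)) (a : ℕ+ × ℕ+ →₀ ℕ) :
    (a.prod fun p k => e p ^ k) ∈ 𝒜 (Finsupp.weight (fun p : ℕ+ × ℕ+ => (p.1 : ℕ) * p.2) a) := by
  rw [Finsupp.weight_apply, Finsupp.prod, Finsupp.sum]
  exact SetLike.prod_mem_graded _ _ _ fun p _ => SetLike.pow_mem_graded _ (he p)

theorem exists_isWeightedHomogeneous_aeval_elem {d : ℕ} {f : PolySymFun} (hf : f ∈ grading d) :
    ∃ P : MvPolynomial (ℕ+ × ℕ+) ℤ,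
      P.IsWeightedHomogeneous (fun p : ℕ+ × ℕ+ => (p.1 : ℕ) * p.2) d ∧
        MvPolynomial.aeval elem P = f := by
  classical
  -- All monomials of `f` cost at least `c`, and `k` counts the levels left up to `d² + 1`, where
  -- only zero remains.
  suffices key : ∀ k c : ℕ, c + k = d * d + 1 → ∀ f ∈ grading d,
      (∀ m, coeff m (f : MvPowerSeries _ ℤ) ≠ 0 → c ≤ cost m) →
      ∃ P : MvPolynomial (ℕ+ × ℕ+) ℤ,
        P.IsWeightedHomogeneous (fun p : ℕ+ × ℕ+ => (p.1 : ℕ) * p.2) d ∧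
          MvPolynomial.aeval elem P = f from
    key (d * d + 1) 0 (zero_add _) f hf fun _ _ => Nat.zero_le _
  intro k
  induction k with
  | zero =>
    intro c hc f hf hcost
    refine ⟨0, MvPolynomial.isWeightedHomogeneous_zero _ _ _, ?_⟩
    rw [map_zero]
    symm
    by_contra hne
    have hex : ∃ n, ∃ m, coeff m (f : MvPowerSeries _ ℤ) ≠ 0 ∧ cost m = n := by
      by_contra! h
      refine hne (Subtype.ext (MvPowerSeries.ext fun m => ?_))
      by_contra h'
      exact h _ m h' rfl
    obtain ⟨m, hm, hmn⟩ := Nat.find_spec hex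
    have hmin : ∀ m', coeff m' (f : MvPowerSeries _ ℤ) ≠ 0 → cost m ≤ cost m' := fun m' h' =>
      hmn ▸ Nat.find_min' hex ⟨m', h', rfl⟩
    have h1 := cost_le_of_antitone (antitone_of_cost_min hm hmin)
    rw [show deg m = d from hf m hm] at h1
    have := hcost m hm
    omega
  | succ k ih =>
    intro c hc f hf hcost
    have hfin : {m | coeff m (f : MvPowerSeries _ ℤ) ≠ 0 ∧ cost m = c}.Finite :=
      (finite_setOf_deg_cost d c).subset fun m hm => ⟨hf m hm.1, hm.2⟩
    set B := hfin.toFinset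
    have hB : ∀ m, m ∈ B ↔ coeff m (f : MvPowerSeries _ ℤ) ≠ 0 ∧ cost m = c := fun m =>
      hfin.mem_toFinset
    have hlead : ∀ m, ∃ a, m ∈ B → lead a = m := by
      intro m
      by_cases hm : m ∈ B
      · obtain ⟨a, ha⟩ := exists_lead_eq (antitone_of_cost_min ((hB m).1 hm).1
          fun m' h' => ((hB m).1 hm).2 ▸ hcost m' h')
        exact ⟨a, fun _ => ha⟩
      · exact ⟨0, fun h => absurd h hm⟩
    choose a ha using hlead
    have hdeg : ∀ m ∈ B, Finsupp.weight (fun p : ℕ+ × ℕ+ => (p.1 : ℕ) * p.2) (a m) = d := by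
      intro m hm
      rw [← deg_lead, ha m hm]
      exact hf m ((hB m).1 hm).1
    -- One correction removes every monomial of cost exactly `c`.
    set g : PolySymFun :=
      ∑ m ∈ B, coeff m (f : MvPowerSeries _ ℤ) • (a m).prod fun p k => elem p ^ k
    have hg : g ∈ grading d := by
      refine sum_mem fun m hm => zsmul_mem ?_ _
      rw [← hdeg m hm]
      exact prod_elem_mem elem_mem _
    obtain ⟨P, hP, hPf⟩ := ih (c + 1) (by omega) (f - g) (sub_mem hf hg) fun m' hm' => by
      have hsub : coeff m' ((f - g : PolySymFun) : MvPowerSeries _ ℤ) =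
          coeff m' (f : MvPowerSeries _ ℤ) - coeff m' (g : MvPowerSeries _ ℤ) := rfl
      rw [hsub, coeff_coe_sum_zsmul] at hm'
      by_contra hlt
      have hle : cost m' ≤ c := by omega
      -- Among monomials of cost at most `c`, the product with leading monomial `m` contains only
      -- `m`.
      have hterm : ∀ m ∈ B, coeff m' (((a m).prod fun p k => elem p ^ k : PolySymFun) :
          MvPowerSeries (ℕ+ × ℕ+) ℤ) = if m = m' then 1 else 0 := by
        intro m hm
        have hl := hasLead_prod (a m)
        rw [ha m hm] at hl
        split_ifs with h
        · rw [← h]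
          exact hl.1
        · by_contra h'
          rcases hl.2 m' h' with h1 | h1
          · exact h h1.symm
          · rw [((hB m).1 hm).2] at h1
            omega
      rw [Finset.sum_congr rfl fun m hm => by rw [hterm m hm]] at hm'
      by_cases hmB : m' ∈ B
      · rw [Finset.sum_eq_single_of_mem m' hmB (fun m _ hne => by rw [if_neg hne, mul_zero]),
          if_pos rfl, mul_one, sub_self] at hm'
        exact hm' rfl
      · rw [Finset.sum_eq_zero fun m hm => by
          rw [if_neg (fun h : m = m' => hmB (h ▸ hm)), mul_zero], sub_zero] at hm'
        exact hmB ((hB m').2 ⟨hm', le_antisymm hle (hcost m' hm')⟩)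
    refine ⟨P + ∑ m ∈ B, MvPolynomial.monomial (a m) (coeff m (f : MvPowerSeries _ ℤ)),
      hP.add (MvPolynomial.IsWeightedHomogeneous.sum _ _ _ fun m hm =>
        MvPolynomial.isWeightedHomogeneous_monomial _ _ _ (hdeg m hm)), ?_⟩
    rw [map_add, hPf, map_sum]
    have : ∑ m ∈ B, MvPolynomial.aeval elem
        (MvPolynomial.monomial (a m) (coeff m (f : MvPowerSeries _ ℤ))) = g := by
      refine Finset.sum_congr rfl fun m _ => ?_
      rw [MvPolynomial.aeval_monomial, zsmul_eq_mul]
      rfl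
    rw [this, sub_add_cancel]

theorem aeval_elem_surjective :
    Function.Surjective (MvPolynomial.aeval (R := ℤ) elem) := by
  intro f
  induction f using DirectSum.Decomposition.inductionOn grading with
  | zero => exact ⟨0, map_zero _⟩
  | homogeneous f =>
    obtain ⟨P, -, hP⟩ := exists_isWeightedHomogeneous_aeval_elem f.2
    exact ⟨P, hP⟩
  | add f g hf hg =>
    obtain ⟨P, rfl⟩ := hf
    obtain ⟨Q, rfl⟩ := hg
    exact ⟨P + Q, map_add _ _ _⟩

/-- `PS` is the polynomial ring in the elementary polysymmetric functions. -/
noncomputable def elemEquiv : MvPolynomial (ℕ+ × ℕ+) ℤ ≃ₐ[ℤ] PolySymFun :=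
  AlgEquiv.ofBijective (MvPolynomial.aeval elem) ⟨aeval_elem_injective, aeval_elem_surjective⟩

end PolySymFun

/-! ### Symmetric functions -/

namespace SymFun

open MvPowerSeries

/-- The `λ`-structure on `Λ`. -/
noncomputable abbrev lambdaStructure : LambdaStructure SymFun :=
  boundedInvariants.lambdaStructure _

open Classical in
/-- The formal sum `∑_j y_j`. -/
noncomputable def sumVars : MvPowerSeries ℕ+ ℤ :=
  fun m => if ∃ j, m = Finsupp.single j 1 then 1 else 0

open Classical in
theorem coeff_sumVars (m : ℕ+ →₀ ℕ) :
    coeff m sumVars = if ∃ j, m = Finsupp.single j 1 then 1 else 0 := rfl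

theorem weight_of_coeff_sumVars {m : ℕ+ →₀ ℕ} (hm : coeff m sumVars ≠ 0) :
    Finsupp.weight (fun _ : ℕ+ => 1) m = 1 := by
  rw [coeff_sumVars] at hm
  obtain ⟨j, rfl⟩ : ∃ j, m = Finsupp.single j 1 := by
    by_contra h
    rw [if_neg h] at hm
    exact hm rfl
  simp [Finsupp.weight_single]

/-- The first power sum `∑_j y_j`. -/
noncomputable def powerSum : SymFun := by
  classical
  refine ⟨sumVars, ⟨1, fun m hm => (weight_of_coeff_sumVars hm).le⟩, fun g _ => ?_⟩
  rw [renameEquiv_eq_iff]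
  intro m
  have key : (∃ j, Finsupp.mapDomain g m = Finsupp.single j 1) ↔
      ∃ j, m = Finsupp.single j 1 := by
    constructor
    · rintro ⟨j, h⟩
      refine ⟨g.symm j, Finsupp.mapDomain_injective g.injective ?_⟩
      rw [h, Finsupp.mapDomain_single, g.apply_symm_apply]
    · rintro ⟨j, rfl⟩
      exact ⟨g j, Finsupp.mapDomain_single⟩
  rw [coeff_sumVars, coeff_sumVars]
  exact if_congr key rfl rfl

theorem powerSum_mem : powerSum ∈ grading 1 := fun _ hm => weight_of_coeff_sumVars hm

/-- The elementary symmetric functions. -/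
noncomputable def elem (j : ℕ+) : SymFun := lambdaStructure.lam j powerSum

theorem elem_mem (j : ℕ+) : elem j ∈ grading j := by
  have := boundedInvariants.isGraded _ j 1 _ powerSum_mem
  rwa [mul_one] at this

theorem elem_mem_scaledGrading (p : ℕ+ × ℕ+) :
    elem p.2 ∈ scaledGrading grading p.1 (p.1 * p.2) := by
  rw [scaledGrading, if_pos (dvd_mul_right _ _), Nat.mul_div_cancel_left _ p.1.pos]
  exact elem_mem p.2

theorem isGraded_scaledGrading (n : ℕ+) :
    lambdaStructure.IsGraded (scaledGrading grading n) := by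
  intro k d f hf
  unfold scaledGrading at hf
  split_ifs at hf with h
  · rw [scaledGrading, if_pos (h.mul_left k), Nat.mul_div_assoc _ h]
    exact boundedInvariants.isGraded _ k _ f hf
  · rw [AddSubgroup.mem_bot] at hf
    subst hf
    rcases eq_or_ne k 0 with rfl | hk
    · rw [LambdaStructure.lam_zero, zero_mul, scaledGrading, if_pos (dvd_zero _), Nat.zero_div]
      exact SetLike.one_mem_graded _
    · rw [LambdaStructure.lam_of_zero _ hk]
      exact zero_mem _

end SymFun

/-! ### Inclusions of symmetric functions -/

namespace PolySymFun

open MvPowerSeries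

theorem coe_incl (n : ℕ+) (f : SymFun) :
    (incl n f : MvPowerSeries (ℕ+ × ℕ+) ℤ) = rename (block n) (f : MvPowerSeries ℕ+ ℤ) := rfl

theorem incl_powerSum (n : ℕ+) : incl n SymFun.powerSum = M n := by
  classical
  refine Subtype.ext (MvPowerSeries.ext fun m => ?_)
  rw [coe_incl]
  change coeff m (rename (block n) SymFun.sumVars) = coeff m (sumVars n)
  have h1 : ∀ j, Finsupp.single (n, j) 1 =
      Finsupp.embDomain (block n) (Finsupp.single j (1 : ℕ)) := fun j => by
    rw [Finsupp.embDomain_single]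
    rfl
  rw [coeff_sumVars]
  by_cases hm : m ∈ Set.range (Finsupp.mapDomain (M := ℕ) (block n))
  · obtain ⟨k, rfl⟩ := hm
    rw [← Finsupp.embDomain_eq_mapDomain, coeff_embDomain_rename, SymFun.coeff_sumVars]
    refine if_congr (exists_congr fun j => ?_) rfl rfl
    rw [h1, (Finsupp.embDomain_injective (block n)).eq_iff]
  · rw [coeff_rename_eq_zero _ _ hm, if_neg]
    rintro ⟨j, rfl⟩
    exact hm ⟨Finsupp.single j 1, by rw [h1, Finsupp.embDomain_eq_mapDomain]⟩

theorem incl_lam (n : ℕ+) (k : ℕ) (f : SymFun) :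
    incl n (SymFun.lambdaStructure.lam k f) = lambdaStructure.lam k (incl n f) := by
  refine LambdaStructure.map_lam_of_adams (incl n).toRingHom f (fun i hi => Subtype.ext ?_) k
  rw [boundedInvariants.coe_adams _ hi]
  change rename (block n) (SymFun.lambdaStructure.adams i f : MvPowerSeries ℕ+ ℤ) =
    expand i hi (rename (block n) (f : MvPowerSeries ℕ+ ℤ))
  rw [boundedInvariants.coe_adams _ hi, expand_rename]

theorem incl_elem (n j : ℕ+) : incl n (SymFun.elem j) = elem (n, j) := by
  rw [SymFun.elem, incl_lam, incl_powerSum]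
  rfl

/-- A surviving monomial would involve only `x_{1*}` and only `x_{n*}`, hence be constant, but `e_j`
is homogeneous of degree `j ≥ 1`. -/
theorem killCompl_incl_of_ne {n : ℕ+} (hn : n ≠ 1) (j : ℕ+) :
    killCompl (block 1) (incl n (SymFun.elem j) : MvPowerSeries (ℕ+ × ℕ+) ℤ) = 0 := by
  ext k
  rw [coeff_killCompl, map_zero, coe_incl]
  by_contra h
  obtain ⟨k', hk', hne⟩ := exists_of_coeff_rename_block h
  have h0 : k' = 0 := by
    ext i
    have h1 := DFunLike.congr_fun hk' (block n i)
    rw [Finsupp.embDomain_apply_self, Finsupp.embDomain_of_notMem_range] at h1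
    · exact h1.symm
    · rintro ⟨a, ha⟩
      exact hn (Prod.ext_iff.1 ha).1.symm
  have h2 := SymFun.elem_mem j k' hne
  rw [h0, map_zero] at h2
  exact j.ne_zero h2.symm

end PolySymFun

/-- Deduced from the theorem for PS: write the image of `f` as a polynomial in the `e_{ij}` and kill
all variables but the `x_{1*}`, which sends `e_{1j}` to `e_j` and the other `e_{ij}` to zero. -/
theorem SymFun.closure_range_elem : Subring.closure (Set.range SymFun.elem) = ⊤ := by
  classical
  rw [eq_top_iff]
  intro f _
  obtain ⟨P, hP⟩ := PolySymFun.aeval_elem_surjective (PolySymFun.incl 1 f)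
  let e : ℕ+ × ℕ+ → SymFun := fun p => if p.1 = 1 then SymFun.elem p.2 else 0
  have hcomp : SymFun.subtype.comp (MvPolynomial.aeval (R := ℤ) e).toRingHom =
      ((MvPowerSeries.killCompl (R := ℤ) (PolySymFun.block 1)).toRingHom.comp
        PolySymFun.subtype).comp (MvPolynomial.aeval (R := ℤ) PolySymFun.elem).toRingHom := by
    apply MvPolynomial.ringHom_ext
    · intro r
      simp
    · rintro ⟨i, j⟩
      simp only [AlgHom.toRingHom_eq_coe, RingHom.comp_apply, RingHom.coe_coe, MvPolynomial.aeval_X,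
        Subring.subtype_apply, e]
      rw [← PolySymFun.incl_elem]
      split_ifs with h
      · subst h
        rw [PolySymFun.coe_incl, MvPowerSeries.killCompl_rename_app]
      · rw [PolySymFun.killCompl_incl_of_ne h]
        rfl
  have hf : f = MvPolynomial.aeval (R := ℤ) e P := by
    apply Subtype.ext
    have h := RingHom.congr_fun hcomp P
    simp only [AlgHom.toRingHom_eq_coe, RingHom.comp_apply, RingHom.coe_coe,
      Subring.subtype_apply, hP] at h
    rw [h, PolySymFun.coe_incl, MvPowerSeries.killCompl_rename_app]
  rw [hf]
  clear hf hP
  induction P using MvPolynomial.induction_on with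
  | C a =>
    rw [MvPolynomial.aeval_C, eq_intCast]
    exact intCast_mem _ a
  | add p q hp hq =>
    rw [map_add]
    exact add_mem hp hq
  | mul_X p i hp =>
    rw [map_mul, MvPolynomial.aeval_X]
    refine mul_mem hp ?_
    simp only [e]
    split_ifs
    · exact Subring.subset_closure ⟨_, rfl⟩
    · exact zero_mem _

theorem SymFun.ringHom_ext {S : Type*} [CommRing S] {φ ψ : SymFun →+* S}
    (h : ∀ j, φ (SymFun.elem j) = ψ (SymFun.elem j)) : φ = ψ := by
  apply RingHom.eq_of_eqOn_set_top
  rw [← SymFun.closure_range_elem]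
  apply RingHom.eqOn_set_closure
  rintro _ ⟨j, rfl⟩
  exact h j

/-! ### Universal properties -/

namespace LambdaStructure

open PowerSeries

variable {R S : Type*} [CommRing R] [CommRing S] {L : LambdaStructure R} {K : LambdaStructure S}

/-- The elements whose `λ_t` is preserved by a ring homomorphism `φ` form a subring. -/
def mapSeriesSubring (hL : L.IsSpecial) (hK : K.IsSpecial) (φ : R →+* S) : Subring R where
  carrier := {x | PowerSeries.map φ (L.series x) = K.series (φ x)}
  one_mem' := by
    rw [Set.mem_ofPred_eq, hL.series_one, map_one φ, hK.series_one]
    simp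
  zero_mem' := by
    rw [Set.mem_ofPred_eq, L.series_zero, map_zero φ, K.series_zero, map_one]
  add_mem' {x y} hx hy := by
    rw [Set.mem_ofPred_eq] at *
    rw [L.series_add, map_mul, map_add, K.series_add, hx, hy]
  mul_mem' {x y} hx hy := by
    rw [Set.mem_ofPred_eq] at *
    rw [hL.series_mul, map_wittMul, map_mul, hK.series_mul, hx, hy]
  neg_mem' {x} hx := by
    rw [Set.mem_ofPred_eq] at *
    have h1 : PowerSeries.map φ (L.series (-x)) * PowerSeries.map φ (L.series x) = 1 := by
      rw [← map_mul, ← L.series_add, neg_add_cancel, L.series_zero, map_one]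
    have h2 : K.series (φ (-x)) * K.series (φ x) = 1 := by
      rw [← K.series_add, map_neg, neg_add_cancel, K.series_zero]
    rw [hx] at h1
    linear_combination K.series (φ (-x)) * h1 - PowerSeries.map φ (L.series (-x)) * h2

/-- In a special λ-ring `λ_t(λ_k x)` is a universal expression in `λ_t(x)`. Hence compatibility
needs checking only on generators as a λ-ring. -/
theorem lam_mem_mapSeriesSubring (hL : L.IsSpecial) (hK : K.IsSpecial) (φ : R →+* S) {x : R}
    (hx : x ∈ mapSeriesSubring hL hK φ) (k : ℕ) : L.lam k x ∈ mapSeriesSubring hL hK φ := by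
  have hx' : PowerSeries.map φ (L.series x) = K.series (φ x) := hx
  have h : φ (L.lam k x) = K.lam k (φ x) := by
    rw [lam, lam, ← hx', coeff_map]
  change PowerSeries.map φ (L.series (L.lam k x)) = K.series (φ (L.lam k x))
  rw [hL.series_lam, map_wittLam, h, hK.series_lam, hx']

theorem map_lam_of_mem_mapSeriesSubring (hL : L.IsSpecial) (hK : K.IsSpecial) (φ : R →+* S)
    {x : R} (hx : x ∈ mapSeriesSubring hL hK φ) (k : ℕ) : φ (L.lam k x) = K.lam k (φ x) := by
  have hx' : PowerSeries.map φ (L.series x) = K.series (φ x) := hx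
  rw [lam, lam, ← hx', coeff_map]

end LambdaStructure

theorem GradedLambdaHom.ext_toRingHom {R S : Type*} [CommRing R] [CommRing S]
    {𝒜 : ℕ → AddSubgroup R} {L : LambdaStructure R} {ℬ : ℕ → AddSubgroup S}
    {M : LambdaStructure S} {φ ψ : GradedLambdaHom 𝒜 L ℬ M} (h : φ.toRingHom = ψ.toRingHom) :
    φ = ψ := by
  obtain ⟨⟨φ, _⟩, _⟩ := φ
  obtain ⟨⟨ψ, _⟩, _⟩ := ψ
  simp only at h
  subst h
  rfl

namespace PolySymFun

theorem mem_of_elem_mem {T : Subring PolySymFun} (hT : ∀ p, elem p ∈ T) (x : PolySymFun) :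
    x ∈ T := by
  obtain ⟨P, rfl⟩ := aeval_elem_surjective x
  induction P using MvPolynomial.induction_on with
  | C a =>
    rw [MvPolynomial.aeval_C, eq_intCast]
    exact intCast_mem _ a
  | add p q hp hq =>
    rw [map_add]
    exact add_mem hp hq
  | mul_X p i hp =>
    rw [map_mul, MvPolynomial.aeval_X]
    exact mul_mem hp (hT i)

theorem ringHom_ext {S : Type*} [CommRing S] {φ ψ : PolySymFun →+* S}
    (h : ∀ p, φ (elem p) = ψ (elem p)) : φ = ψ :=
  RingHom.ext fun x => mem_of_elem_mem (T := φ.eqLocus ψ) h x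

/-- A choice of elements of the right degrees defines a graded ring homomorphism on `PS`. -/
noncomputable def lift {S : Type*} [CommRing S] (𝒮 : ℕ → AddSubgroup S) [GradedRing 𝒮]
    (e : ℕ+ × ℕ+ → S) (he : ∀ p, e p ∈ 𝒮 (p.1 * p.2)) : GradedRingHom grading 𝒮 where
  toRingHom := (MvPolynomial.aeval (R := ℤ) e).toRingHom.comp elemEquiv.symm.toRingEquiv.toRingHom
  map_mem := by
    intro d x hx
    obtain ⟨P, hP, rfl⟩ := exists_isWeightedHomogeneous_aeval_elem hx
    have h1 : elemEquiv.symm (MvPolynomial.aeval elem P) = P := elemEquiv.symm_apply_apply P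
    change MvPolynomial.aeval e (elemEquiv.symm (MvPolynomial.aeval elem P)) ∈ 𝒮 d
    rw [h1, MvPolynomial.aeval_def, MvPolynomial.eval₂_eq]
    refine sum_mem fun a ha => ?_
    rw [eq_intCast, ← zsmul_eq_mul]
    refine zsmul_mem ?_ _
    rw [← hP (MvPolynomial.mem_support_iff.1 ha)]
    exact prod_elem_mem he a

theorem lift_elem {S : Type*} [CommRing S] (𝒮 : ℕ → AddSubgroup S) [GradedRing 𝒮]
    (e : ℕ+ × ℕ+ → S) (he : ∀ p, e p ∈ 𝒮 (p.1 * p.2)) (p : ℕ+ × ℕ+) :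
    (lift 𝒮 e he).toRingHom (elem p) = e p := by
  have h1 : elemEquiv.symm (elem p) = MvPolynomial.X p := by
    rw [AlgEquiv.symm_apply_eq]
    exact (MvPolynomial.aeval_X _ _).symm
  change MvPolynomial.aeval e (elemEquiv.symm (elem p)) = e p
  rw [h1, MvPolynomial.aeval_X]

theorem isSpecial : lambdaStructure.IsSpecial := boundedInvariants.isSpecial _

/-- A ring homomorphism on `PS` that commutes with `λ_t` on the generators `M_d` commutes with all
`λ`-operations. -/
theorem map_lam_of_map_elem {R : Type*} [CommRing R] {K : LambdaStructure R} (hK : K.IsSpecial)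
    (φ : PolySymFun →+* R) (h : ∀ p, φ (elem p) = K.lam p.2 (φ (M p.1))) (k : ℕ)
    (x : PolySymFun) : φ (lambdaStructure.lam k x) = K.lam k (φ x) := by
  refine LambdaStructure.map_lam_of_mem_mapSeriesSubring isSpecial hK φ ?_ k
  refine mem_of_elem_mem (fun p => LambdaStructure.lam_mem_mapSeriesSubring _ _ _ ?_ _) x
  change PowerSeries.map φ (lambdaStructure.series (M p.1)) = K.series (φ (M p.1))
  ext n
  rw [PowerSeries.coeff_map]
  rcases Nat.eq_zero_or_pos n with rfl | hn
  · rw [LambdaStructure.coeff_zero, LambdaStructure.coeff_zero, map_one]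
  · exact h (p.1, ⟨n, hn⟩)

theorem elem_one (d : ℕ+) : elem (d, 1) = M d := LambdaStructure.lam_one _ _

/-- Freeness of PS on the `e_{ij}` gives `F`; it restricts to the given maps because the `e_j`
generate Λ, and it is unique because the `e_{ij}` are images of the `e_j`. -/
theorem existsUnique_gradedRingHom {S : Type*} [CommRing S] (𝒮 : ℕ → AddSubgroup S) [GradedRing 𝒮]
    (f : ∀ n : ℕ+, GradedRingHom (scaledGrading SymFun.grading n) 𝒮) :
    ∃! F : GradedRingHom grading 𝒮, ∀ (n : ℕ+) (x : SymFun), F (incl n x) = f n x := by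
  let F := lift 𝒮 (fun p => f p.1 (SymFun.elem p.2)) fun p =>
    (f p.1).map_mem (SymFun.elem_mem_scaledGrading p)
  have hF : ∀ p, F.toRingHom (elem p) = f p.1 (SymFun.elem p.2) := lift_elem _ _ _
  refine ⟨F, fun n x => ?_, fun G hG => ?_⟩
  · have h : F.toRingHom.comp (incl n).toRingHom = (f n).toRingHom := by
      apply SymFun.ringHom_ext
      intro j
      change F.toRingHom (incl n (SymFun.elem j)) = _
      rw [incl_elem, hF]
      rfl
    exact RingHom.congr_fun h x
  · have h : G.toRingHom = F.toRingHom := by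
      apply ringHom_ext
      intro p
      rw [hF, ← hG, incl_elem]
      rfl
    exact DFunLike.ext _ _ fun x => RingHom.congr_fun h x

theorem existsUnique_gradedLambdaHom {R : Type*} [CommRing R] (𝒜 : ℕ → AddSubgroup R)
    [GradedRing 𝒜] (K : LambdaStructure R) (hK : K.IsSpecial)
    (f : ∀ n : ℕ+, GradedLambdaHom (scaledGrading SymFun.grading n) SymFun.lambdaStructure 𝒜 K) :
    ∃! F : GradedLambdaHom grading lambdaStructure 𝒜 K,
      ∀ (n : ℕ+) (x : SymFun), F.toRingHom (incl n x) = (f n).toRingHom x := by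
  obtain ⟨F, hF, hFu⟩ := existsUnique_gradedRingHom 𝒜 fun n => (f n).toGradedRingHom
  have hF' : ∀ n x, F.toRingHom (incl n x) = (f n).toRingHom x := hF
  refine ⟨⟨F, fun k _ => map_lam_of_map_elem hK F.toRingHom (fun p => ?_) k⟩, hF', fun G hG => ?_⟩
  -- With `p = (n, j)`: `F(e_{nj}) = f_n(λ_j(e_1)) = λ_j(f_n(e_1)) = λ_j(F(M_n))`.
  · have h1 := hF' p.1 (SymFun.elem p.2)
    rw [incl_elem, SymFun.elem, (f p.1).map_lam p.2 p.2.pos, ← hF', incl_powerSum] at h1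
    exact h1
  · apply GradedLambdaHom.ext_toRingHom
    have h := hFu G.toGradedRingHom hG
    exact congrArg GradedRingHom.toRingHom h

/-- The relation `e_{ij} = λ_j(M_i)` forces the images of the generators. Conversely `e_{ij} ↦
λ_j(r_i)` has the right degree because `R` is graded, and it sends `M_i = e_{i1}` to `r_i`. -/
theorem bijective_eval_M {R : Type*} [CommRing R] (𝒜 : ℕ → AddSubgroup R) [GradedRing 𝒜]
    (K : LambdaStructure R) (hK : K.IsSpecial) (hgr : K.IsGraded 𝒜) :
    Function.Bijective (fun (φ : GradedLambdaHom grading lambdaStructure 𝒜 K) (d : ℕ+) =>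
      (⟨φ.toRingHom (M d), φ.map_mem (M_mem d)⟩ : 𝒜 (d : ℕ))) := by
  constructor
  · intro φ ψ h
    apply GradedLambdaHom.ext_toRingHom
    apply ringHom_ext
    intro p
    have h1 : φ.toRingHom (M p.1) = ψ.toRingHom (M p.1) :=
      congrArg Subtype.val (congrFun h p.1)
    rw [elem, φ.map_lam p.2 p.2.pos, ψ.map_lam p.2 p.2.pos, h1]
  · intro r
    let F := lift 𝒜 (fun p => K.lam p.2 (r p.1)) fun p => by
      rw [mul_comm]
      exact hgr _ _ _ (r p.1).2
    have hF : ∀ p, F.toRingHom (elem p) = K.lam p.2 (r p.1) := lift_elem _ _ _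
    have hM : ∀ d, F.toRingHom (M d) = r d := fun d => by
      rw [← elem_one, hF, PNat.one_coe, LambdaStructure.lam_one]
    refine ⟨⟨F, fun k _ => map_lam_of_map_elem hK F.toRingHom (fun p => ?_) k⟩, ?_⟩
    · rw [hF, hM]
    · funext d
      exact Subtype.ext (hM d)

end PolySymFun

theorem mainTheorem6 :
    ∃ (LΛ : LambdaStructure SymFun) (L : LambdaStructure PolySymFun),
      -- the usual `λ`-structures: Adams operations raise all variables to the `n`-th power
      (∀ (n : ℕ) (hn : n ≠ 0) (f : SymFun),
        (LΛ.adams n f : MvPowerSeries ℕ+ ℤ) = MvPowerSeries.expand n hn f) ∧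
      (∀ (n : ℕ) (hn : n ≠ 0) (f : PolySymFun),
        (L.adams n f : MvPowerSeries (ℕ+ × ℕ+) ℤ) = MvPowerSeries.expand n hn f) ∧
      -- `Λ⟨n⟩` and `PS` are special graded `λ`-rings
      LΛ.IsSpecial ∧
      (∀ n : ℕ+, LΛ.IsGraded (scaledGrading SymFun.grading n)) ∧
      L.IsSpecial ∧
      L.IsGraded PolySymFun.grading ∧
      -- the inclusions `Λ⟨n⟩ → PS` commute with the `λ`-operations
      (∀ (n : ℕ+) (k : ℕ) (f : SymFun),
        PolySymFun.incl n (LΛ.lam k f) = L.lam k (PolySymFun.incl n f)) ∧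
      -- `PS = ⨂ Λ⟨n⟩`, the coproduct of graded rings
      (∀ (S : Type u) [CommRing S] (𝒮 : ℕ → AddSubgroup S) [GradedRing 𝒮]
        (f : ∀ n : ℕ+, GradedRingHom (scaledGrading SymFun.grading n) 𝒮),
        ∃! F : GradedRingHom PolySymFun.grading 𝒮,
          ∀ (n : ℕ+) (x : SymFun), F (PolySymFun.incl n x) = f n x) ∧
      -- `PS` is the coproduct of the `Λ⟨n⟩` among special graded `λ`-rings
      (∀ (R : Type u) [CommRing R] (𝒜 : ℕ → AddSubgroup R) [GradedRing 𝒜]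
        (K : LambdaStructure R), K.IsSpecial → K.IsGraded 𝒜 →
        ∀ f : ∀ n : ℕ+, GradedLambdaHom (scaledGrading SymFun.grading n) LΛ 𝒜 K,
        ∃! F : GradedLambdaHom PolySymFun.grading L 𝒜 K,
          ∀ (n : ℕ+) (x : SymFun),
            F.toRingHom (PolySymFun.incl n x) = (f n).toRingHom x) ∧
      -- the universal property
      (∀ (R : Type u) [CommRing R] (𝒜 : ℕ → AddSubgroup R) [GradedRing 𝒜]
        (K : LambdaStructure R), K.IsSpecial → K.IsGraded 𝒜 →
        Function.Bijective
          (fun (φ : GradedLambdaHom PolySymFun.grading L 𝒜 K) (d : ℕ+) =>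
            (⟨φ.toRingHom (PolySymFun.M d), φ.map_mem (PolySymFun.M_mem d)⟩ : 𝒜 (d : ℕ)))) := by
  exact ⟨SymFun.lambdaStructure, PolySymFun.lambdaStructure,
    fun _ hn f => boundedInvariants.coe_adams _ hn f,
    fun _ hn f => boundedInvariants.coe_adams _ hn f,
    boundedInvariants.isSpecial _, SymFun.isGraded_scaledGrading,
    PolySymFun.isSpecial, boundedInvariants.isGraded _, PolySymFun.incl_lam,
    fun _ _ 𝒮 _ f => PolySymFun.existsUnique_gradedRingHom 𝒮 f,
    fun _ _ 𝒜 _ K hK _ f => PolySymFun.existsUnique_gradedLambdaHom 𝒜 K hK f,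
    fun _ _ 𝒜 _ K hK hgr => PolySymFun.bijective_eval_M 𝒜 K hK hgr⟩
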